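/- **Setting.** Let $\mathbb X$ be a compact metric space, $\mathbb S=C(\mathbb X)$ with the supremum norm and its Borel $\sigma$-algebra, $\tau:\mathbb X\to[0,\infty)$ continuous, and $\mathbb M$ the set of Gaussian probability measures on $\mathbb S$ with the $\sigma$-algebra generated by the maps $\nu\mapsto\nu(A)$, $A\subset\mathbb S$ Borel. For $\nu\in\mathbb M$ let $m_\nu,k_\nu$ be its mean and covariance functions and $s_\nu^2(x)=k_\nu(x,x)+\tau^2(x)$; write $\nu_n\to\nu$ if $m_{\nu_n}\to m_\nu$ and $k_{\nu_n}\to k_\nu$ uniformly. For $x\in\mathbb X$, $z\in\mathbb R$ let $\mathrm{Cond}_{x,z}(\nu)\in\mathbb M$ be the Gaussian measure with mean function $m_\nu+k_\nu(\cdot,x)\,(z-m_\nu(x))/s_\nu^2(x)$ and covariance function $k_\nu-k_\nu(\cdot,x)k_\nu(x,\cdot)/s_\nu^2(x)$ (it is $\nu$ if $s_\nu^2(x)=0$). Let $\xi$ be a Gaussian random element of $\mathbb S$ (a Gaussian process on $\mathbb X$ with continuous paths) with distribution $\mathrm P_0^\xi\in\mathbb M$, and let $U_1,U_2,\dots$ be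 i.i.d. $\mathcal N(0,1)$ variables, independent of $\xi$. A *sequential design* is a sequence $(X_n)_{n\ge1}$ of $\mathbb X$-valued random variables such that $X_n$ is $\mathcal F_{n-1}$-measurable for all $n\ge1$, where $Z_n=\xi(X_n)+\tau(X_n)U_n$, $\mathcal F_n=\sigma(X_1,Z_1,\dots,X_n,Z_n)$ and $\mathcal F_0$ is trivial. Put $\mathcal F_\infty=\bigvee_n\mathcal F_n$, and let $\mathrm P_{n+1}^\xi=\mathrm{Cond}_{X_{n+1},Z_{n+1}}(\mathrm P_n^\xi)$, which is the conditional distribution of $\xi$ given $\mathcal F_{n+1}$. Let $\mathrm P_\infty^\xi$ be a conditional distribution of $\xi$ given $\mathcal F_\infty$ that is an $\mathcal F_\infty$-measurable random element of $\mathbb M$. For a Gaussian random element $\xi$ of $\mathbb S$ on a probability space $(\Omega,\mathcal F,\mathrm P)$, let $\mathfrak P(\xi)$ be the set of random elements of $\mathbb M$ that are conditional distributions of $\xi$ given some $\sigma$-algebra $\mathcal F'\subset\mathcal F$. A measurable functional $\mathcal H_1:\mathbb M\to\mathbb R$ * is *$\mathfrak P$-uniformly integrable* if for every such $\xi$ the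 family $(\mathcal H_1(\boldsymbol\nu))_{\boldsymbol\nu\in\mathfrak P(\xi)}$ is uniformly integrable; * is *$\mathfrak P$-continuous* if for every such $\xi$ and all $\boldsymbol\nu_n,\boldsymbol\nu_\infty\in\mathfrak P(\xi)$ with $\boldsymbol\nu_n\to\boldsymbol\nu_\infty$ a.s., $\mathcal H_1(\boldsymbol\nu_n)\to\mathcal H_1(\boldsymbol\nu_\infty)$ a.s.; * has the *supermartingale property* if for every $\mathrm P_0^\xi\in\mathbb M$ and every sequential design, $(\mathcal H_1(\mathrm P_n^\xi))_{n\ge1}$ is an $(\mathcal F_n)$-supermartingale. For a measurable $\mathcal H:\mathbb M\to[0,\infty)$ put, with $\phi$ the standard normal density, $$\mathcal J_x(\nu)=\iint_{\mathbb S\times\mathbb R}\mathcal H\bigl(\mathrm{Cond}_{x,\,f(x)+u\tau(x)}(\nu)\bigr)\,\nu(\mathrm df)\,\phi(u)\,\mathrm du\in[0,\infty],\qquad \mathcal G(\nu)=\sup_{x\in\mathbb X}\bigl(\mathcal H(\nu)-\mathcal J_x(\nu)\bigr).$$ A sequential design is *quasi-SUR* for $\mathcal H$ if there are positive reals $\varepsilon_n\to0$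 and an integer $n_0$ such that, almost surely, $\mathcal J_{X_{n+1}}(\mathrm P_n^\xi)\le\inf_{x}\mathcal J_x(\mathrm P_n^\xi)+\varepsilon_n$ for all $n\ge n_0$. **Theorem.** Let $\mathcal H:\mathbb M\to[0,\infty)$ be measurable with $\mathcal H=\mathcal H_0+\mathcal H_1$, where $\mathcal H_0(\nu)=\int_{\mathbb S}L_0\,\mathrm d\nu$ for some measurable $L_0:\mathbb S\to\mathbb R$ that is $\nu$-integrable for all $\nu\in\mathbb M$, and where $\mathcal H_1:\mathbb M\to\mathbb R$ is measurable, $\mathfrak P$-uniformly integrable, $\mathfrak P$-continuous and has the supermartingale property. Then, for any quasi-SUR sequential design for $\mathcal H$, a version $\mathrm P_\infty^\xi$ as above exists, and every such version satisfies $\mathcal G(\mathrm P_\infty^\xi)=0$ almost surely. -/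

import Mathlib

open MeasureTheory ProbabilityTheory Filter Topology
open scoped NNReal ENNReal

universe u w

set_option linter.unusedSectionVars false

namespace SUR

noncomputable section

variable {X : Type u} [MetricSpace X] [CompactSpace X]

/-! ### Gaussian measures on the space of continuous functions -/

/-- The Borel `σ`-algebra of the Banach space `C(X, ℝ)` (supremum norm). -/
instance instMeasurableSpaceC : MeasurableSpace C(X, ℝ) := borel _

instance instBorelSpaceC : BorelSpace C(X, ℝ) := ⟨rfl⟩

variable (X) in
/-- The set of all Gaussian measures on `C(X, ℝ)`. As a subtype of `Measure C(X, ℝ)` it carries the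
`σ`-algebra generated by the evaluation maps `ν ↦ ν A`, for `A` Borel. -/
abbrev GM : Type u := {ν : Measure C(X, ℝ) // IsGaussian ν}

/-- A Gaussian measure on `C(X, ℝ)`, as a measure. -/
abbrev GM.meas (ν : GM X) : Measure C(X, ℝ) := ν.1

instance instIsGaussianMeas (ν : GM X) : IsGaussian ν.meas := ν.2

/-- The mean function `m_ν`. -/
def GM.mean (ν : GM X) (x : X) : ℝ := ∫ f, f x ∂ν.meas

/-- The covariance function `k_ν`. -/
def GM.cov (ν : GM X) (x y : X) : ℝ := cov[fun f : C(X, ℝ) => f x, fun f : C(X, ℝ) => f y; ν.meas]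

/-- Convergence in the space of Gaussian measures: uniform convergence of the mean functions on `X`
and of the covariance functions on `X × X`. -/
def GM.TendstoGM (ν : ℕ → GM X) (ν' : GM X) : Prop :=
  TendstoUniformly (fun n => (ν n).mean) ν'.mean atTop ∧
    TendstoUniformly (fun n (p : X × X) => (ν n).cov p.1 p.2) (fun p => ν'.cov p.1 p.2) atTop

lemma GM.memLp_eval (ν : GM X) (x : X) : MemLp (fun f : C(X, ℝ) => f x) 2 ν.meas :=
  IsGaussian.memLp_dual ν.meas (ContinuousMap.evalCLM ℝ x) 2 (by simp)

lemma GM.continuous_cov (ν : GM X) (x : X) : Continuous fun y => ν.cov y x := by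
  have hint : Integrable (fun f : C(X, ℝ) => (f x - ν.mean x) • f) ν.meas := by
    have h1 : MemLp (fun f : C(X, ℝ) => f x - ν.mean x) 2 ν.meas :=
      (ν.memLp_eval x).sub (memLp_const _)
    have h2 : MemLp (fun f : C(X, ℝ) => f) 2 ν.meas := IsGaussian.memLp_two_id
    exact memLp_one_iff_integrable.1 (h2.smul h1)
  have hcov : ∀ y, ν.cov y x = (∫ f : C(X, ℝ), (f x - ν.mean x) • f ∂ν.meas) y := by
    intro y
    have h3 : (∫ f : C(X, ℝ), (f x - ν.mean x) • f ∂ν.meas) y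
        = ∫ f : C(X, ℝ), (f x - ν.mean x) * f y ∂ν.meas :=
      ((ContinuousMap.evalCLM ℝ y).integral_comp_comm hint).symm
    rw [h3]
    have h4 : Integrable (fun f : C(X, ℝ) => (f x - ν.mean x) * f y) ν.meas :=
      (ContinuousMap.evalCLM ℝ y).integrable_comp hint
    have h5 : Integrable (fun f : C(X, ℝ) => f x - ν.mean x) ν.meas :=
      ((ν.memLp_eval x).integrable one_le_two).sub (integrable_const _)
    have h6 : ∫ f : C(X, ℝ), (f x - ν.mean x) ∂ν.meas = 0 := by
      rw [integral_sub ((ν.memLp_eval x).integrable one_le_two) (integrable_const _)]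
      simp [GM.mean]
    calc ν.cov y x = ∫ f : C(X, ℝ), ((f x - ν.mean x) * f y - ν.mean y * (f x - ν.mean x)) ∂ν.meas := by
          simp only [GM.cov, covariance, GM.mean]
          congr 1; ext f; ring
      _ = _ := by
          rw [integral_sub h4 (h5.const_mul _), integral_const_mul, h6]; simp
  simp_rw [hcov]
  exact ContinuousMap.continuous _

/-! ### Conditioning on one noisy observation -/

/-- The predictive variance `s_ν²(x) = k_ν(x, x) + τ²(x)`. -/
def predVar (τ : C(X, ℝ≥0)) (ν : GM X) (x : X) : ℝ := ν.cov x x + (τ x : ℝ) ^ 2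

/-- The function `y ↦ k_ν(y, x) / s_ν²(x)` (the null function when `s_ν²(x) = 0`). -/
def gainFun (τ : C(X, ℝ≥0)) (ν : GM X) (x : X) : C(X, ℝ) where
  toFun y := ν.cov y x / predVar τ ν x
  continuous_toFun := (ν.continuous_cov x).div_const _

/-- The random function `f + (z - f(x) - τ(x) u) k_ν(·, x) / s_ν²(x)`, as a function of `(f, u)`. -/
def condMap (τ : C(X, ℝ≥0)) (x : X) (z : ℝ) (ν : GM X) (p : C(X, ℝ) × ℝ) : C(X, ℝ) :=
  p.1 + (z - p.1 x - τ x * p.2) • gainFun τ ν x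

lemma continuous_condMap (τ : C(X, ℝ≥0)) (x : X) (z : ℝ) (ν : GM X) :
    Continuous (condMap τ x z ν) := by
  unfold condMap
  have : Continuous fun p : C(X, ℝ) × ℝ => p.1 x :=
    (ContinuousEvalConst.continuous_eval_const x).comp continuous_fst
  fun_prop

lemma isGaussian_condMap (τ : C(X, ℝ≥0)) (x : X) (z : ℝ) (ν : GM X) :
    IsGaussian ((ν.meas.prod (gaussianReal 0 1)).map (condMap τ x z ν)) := by
  let E : C(X, ℝ) →L[ℝ] ℝ := ContinuousMap.evalCLM ℝ x
  let L : C(X, ℝ) × ℝ →L[ℝ] C(X, ℝ) :=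
    ContinuousLinearMap.fst ℝ C(X, ℝ) ℝ -
      (E.comp (ContinuousLinearMap.fst ℝ C(X, ℝ) ℝ) +
        (τ x : ℝ) • ContinuousLinearMap.snd ℝ C(X, ℝ) ℝ).smulRight (gainFun τ ν x)
  have h : condMap τ x z ν = (fun f => f + z • gainFun τ ν x) ∘ L := by
    ext p y
    simp [condMap, L, E]
    ring
  rw [h, ← Measure.map_map (by fun_prop) (by fun_prop)]
  infer_instance

/-- The conditioning operator `Cond_{x,z}`: the conditional distribution of a process with
distribution `ν`, given that a noisy observation at `x` (with noise variance `τ²(x)`) is equal to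
`z`. It is the Gaussian measure with mean function `m_ν + k_ν(·, x) (z - m_ν(x)) / s_ν²(x)` and
covariance function `k_ν - k_ν(·, x) k_ν(x, ·) / s_ν²(x)`, see `mean_condPt` and `cov_condPt` (and
`ν` itself if `s_ν²(x) = 0`), realized as the distribution of
`f + (z - f(x) - τ(x) u) k_ν(·, x) / s_ν²(x)`, where `f ∼ ν` and `u ∼ N(0, 1)` are independent. -/
def condPt (τ : C(X, ℝ≥0)) (x : X) (z : ℝ) (ν : GM X) : GM X :=
  ⟨(ν.meas.prod (gaussianReal 0 1)).map (condMap τ x z ν), isGaussian_condMap τ x z ν⟩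

lemma memLp_eval_fst (ν : GM X) (y : X) :
    MemLp (fun p : C(X, ℝ) × ℝ => p.1 y) 2 (ν.meas.prod (gaussianReal 0 1)) :=
  (ν.memLp_eval y).comp_fst _

lemma memLp_snd (ν : GM X) :
    MemLp (fun p : C(X, ℝ) × ℝ => p.2) 2 (ν.meas.prod (gaussianReal 0 1)) :=
  (memLp_id_gaussianReal' (μ := 0) (v := 1) 2 (by simp)).comp_snd ν.meas

lemma aestronglyMeasurable_eval (μ : Measure C(X, ℝ)) (y : X) :
    AEStronglyMeasurable (fun f : C(X, ℝ) => f y) μ :=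
  (ContinuousMap.evalCLM ℝ y).continuous.aestronglyMeasurable

/-- The mean function of `Cond_{x,z}(ν)`. -/
theorem mean_condPt (τ : C(X, ℝ≥0)) (x : X) (z : ℝ) (ν : GM X) (y : X) :
    (condPt τ x z ν).mean y = ν.mean y + ν.cov y x / predVar τ ν x * (z - ν.mean x) := by
  have hE : ∀ y : X, ∫ p : C(X, ℝ) × ℝ, p.1 y ∂(ν.meas.prod (gaussianReal 0 1)) = ν.mean y := by
    intro y
    rw [integral_fun_fst (fun f : C(X, ℝ) => f y)]
    simp [GM.mean]
  have hU : ∫ p : C(X, ℝ) × ℝ, p.2 ∂(ν.meas.prod (gaussianReal 0 1)) = 0 := by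
    rw [integral_fun_snd (fun u : ℝ => u)]
    simp
  have hA : ∀ y : X, Integrable (fun p : C(X, ℝ) × ℝ => p.1 y) (ν.meas.prod (gaussianReal 0 1)) :=
    fun y => (memLp_eval_fst ν y).integrable one_le_two
  have hB : Integrable (fun p : C(X, ℝ) × ℝ => p.2) (ν.meas.prod (gaussianReal 0 1)) :=
    (memLp_snd ν).integrable one_le_two
  have h1 : (condPt τ x z ν).mean y = ∫ p : C(X, ℝ) × ℝ,
      (p.1 y + (z - p.1 x - τ x * p.2) * gainFun τ ν x y) ∂(ν.meas.prod (gaussianReal 0 1)) := by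
    unfold GM.mean
    exact integral_map (continuous_condMap τ x z ν).measurable.aemeasurable
      (aestronglyMeasurable_eval _ y)
  have i1 : Integrable (fun p : C(X, ℝ) × ℝ => z - p.1 x) (ν.meas.prod (gaussianReal 0 1)) :=
    (integrable_const z).sub (hA x)
  have i2 : Integrable (fun p : C(X, ℝ) × ℝ => τ x * p.2) (ν.meas.prod (gaussianReal 0 1)) :=
    hB.const_mul _
  have i3 : Integrable (fun p : C(X, ℝ) × ℝ => (z - p.1 x - τ x * p.2) * gainFun τ ν x y)
      (ν.meas.prod (gaussianReal 0 1)) := (i1.sub i2).mul_const _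
  rw [h1, integral_add (hA y) i3, integral_mul_const, integral_sub i1 i2,
    integral_sub (integrable_const z) (hA x), integral_const_mul, hU, hE, hE]
  simp [gainFun]
  ring

/-- The covariance function of `Cond_{x,z}(ν)`. -/
theorem cov_condPt (τ : C(X, ℝ≥0)) (x : X) (z : ℝ) (ν : GM X) (y y' : X) :
    (condPt τ x z ν).cov y y' = ν.cov y y' - ν.cov y x * ν.cov x y' / predVar τ ν x := by
  set Q := ν.meas.prod (gaussianReal 0 1) with hQ
  set g := gainFun τ ν x with hg
  have hA := memLp_eval_fst ν
  have hB := memLp_snd ν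
  have hAA : ∀ y y' : X, cov[fun p : C(X, ℝ) × ℝ => p.1 y, fun p => p.1 y'; Q] = ν.cov y y' := by
    intro y y'
    have hf : Q.map Prod.fst = ν.meas := by rw [hQ, Measure.map_fst_prod]; simp
    have h := covariance_map_fun (μ := Q) (Z := Prod.fst) (X := fun f : C(X, ℝ) => f y)
      (Y := fun f : C(X, ℝ) => f y') (aestronglyMeasurable_eval _ y) (aestronglyMeasurable_eval _ y')
      measurable_fst.aemeasurable
    rw [hf] at h
    exact h.symm
  have hAU : ∀ y : X, cov[fun p : C(X, ℝ) × ℝ => p.1 y, fun p => p.2; Q] = 0 := fun y =>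
    covariance_fst_snd_prod (ν.memLp_eval y) (memLp_id_gaussianReal' (μ := 0) (v := 1) 2 (by simp))
  have hUU : cov[fun p : C(X, ℝ) × ℝ => p.2, fun p => p.2; Q] = 1 := by
    have hs : Q.map Prod.snd = gaussianReal 0 1 := by rw [hQ, Measure.map_snd_prod]; simp
    have h := covariance_map_fun (μ := Q) (Z := Prod.snd) (X := fun u : ℝ => u)
      (Y := fun u : ℝ => u) (by fun_prop) (by fun_prop) measurable_snd.aemeasurable
    rw [hs] at h
    rw [← h, covariance_self (by fun_prop)]
    exact variance_id_gaussianReal.trans (by simp)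
  have hW : MemLp (fun p : C(X, ℝ) × ℝ => p.1 x + τ x * p.2) 2 Q := (hA x).add (hB.const_mul _)
  have hAW : ∀ y : X, cov[fun p : C(X, ℝ) × ℝ => p.1 y, fun p => p.1 x + τ x * p.2; Q]
      = ν.cov y x := by
    intro y
    have h := covariance_add_right (hA y) (hA x) (hB.const_mul (τ x : ℝ))
    refine h.trans ?_
    rw [covariance_const_mul_right, hAA, hAU]
    ring
  have hWW : cov[fun p : C(X, ℝ) × ℝ => p.1 x + τ x * p.2, fun p => p.1 x + τ x * p.2; Q]
      = predVar τ ν x := by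
    have h := covariance_add_left (hA x) (hB.const_mul (τ x : ℝ)) hW
    refine h.trans ?_
    rw [hAW, covariance_const_mul_left]
    have h' := covariance_add_right hB (hA x) (hB.const_mul (τ x : ℝ))
    have h'' : cov[fun p : C(X, ℝ) × ℝ => p.2, fun p => p.1 x + τ x * p.2; Q] = τ x := by
      refine h'.trans ?_
      rw [covariance_const_mul_right, covariance_comm, hAU, hUU]
      ring
    rw [h'', predVar]
    ring
  have h1 : (condPt τ x z ν).cov y y' =
      cov[fun p : C(X, ℝ) × ℝ => p.1 y - g y * (p.1 x + τ x * p.2) + z * g y,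
        fun p => p.1 y' - g y' * (p.1 x + τ x * p.2) + z * g y'; Q] := by
    unfold GM.cov
    refine (covariance_map_fun (aestronglyMeasurable_eval _ y) (aestronglyMeasurable_eval _ y')
      (continuous_condMap τ x z ν).measurable.aemeasurable).trans ?_
    congr 1 <;>
    · ext p
      simp [condMap, hg]
      ring
  have hI : ∀ y : X, MemLp (fun p : C(X, ℝ) × ℝ => p.1 y - g y * (p.1 x + τ x * p.2)) 2 Q :=
    fun y => (hA y).sub (hW.const_mul _)
  rw [h1, covariance_add_const_left ((hI y).integrable one_le_two),
    covariance_add_const_right ((hI y').integrable one_le_two),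
    covariance_fun_sub_fun_sub (hA y) (hW.const_mul _) (hA y') (hW.const_mul _),
    covariance_const_mul_right, covariance_const_mul_right, covariance_const_mul_left,
    covariance_const_mul_left, hAA, hAW, hWW, covariance_comm, hAW]
  have hsymm : ν.cov x y' = ν.cov y' x := covariance_comm _ _
  rw [hsymm]
  have hgy : ∀ y, g y = ν.cov y x / predVar τ ν x := fun y => rfl
  rw [hgy, hgy]
  by_cases h0 : predVar τ ν x = 0
  · simp [h0]
  · field_simp
    ring

/-! ### Sequential designs -/

section Observations

variable {Ω : Type w}

/-- The observations `Z_n = ξ(X_n) + τ(X_n) U_n` (indices start at `0`). -/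
def obs (τ : C(X, ℝ≥0)) (ξ : Ω → C(X, ℝ)) (U : ℕ → Ω → ℝ) (pt : ℕ → Ω → X) (n : ℕ) (ω : Ω) : ℝ :=
  ξ ω (pt n ω) + τ (pt n ω) * U n ω

/-- The `σ`-algebra `ℱ_n` generated by the first `n` design points and the first `n` observations
(trivial for `n = 0`). -/
@[reducible] def obsSigma [MeasurableSpace X] (τ : C(X, ℝ≥0)) (ξ : Ω → C(X, ℝ)) (U : ℕ → Ω → ℝ)
    (pt : ℕ → Ω → X) (n : ℕ) : MeasurableSpace Ω :=
  ⨆ i : ℕ, ⨆ _ : i < n,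
    MeasurableSpace.comap (pt i) inferInstance ⊔
      MeasurableSpace.comap (obs τ ξ U pt i) inferInstance

end Observations

variable [MeasurableSpace X] [BorelSpace X]

/-- A Gaussian process with continuous sample paths, seen as a Gaussian random element `ξ` of
`C(X, ℝ)` with distribution `ν₀`, observed with independent Gaussian noise at the points of a
(non-randomized) sequential design. With indices starting at `0`, `pt n` is the design point
`X_{n+1}`, which is `ℱ_n`-measurable, and `U n` is the noise variable of the same observation. -/
structure SeqDesign (τ : C(X, ℝ≥0)) (ν₀ : GM X) (Ω : Type w) [MeasurableSpace Ω] (P : Measure Ω)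
    where
  ξ : Ω → C(X, ℝ)
  U : ℕ → Ω → ℝ
  pt : ℕ → Ω → X
  measurable_ξ : Measurable ξ
  law_ξ : P.map ξ = ν₀.meas
  measurable_U : ∀ n, Measurable (U n)
  law_U : ∀ n, P.map (U n) = gaussianReal 0 1
  iIndepFun_U : iIndepFun U P
  indepFun_ξ_U : IndepFun ξ (fun ω n => U n ω) P
  measurable_pt : ∀ n, Measurable[obsSigma τ ξ U pt n] (pt n)

namespace SeqDesign

variable {τ : C(X, ℝ≥0)} {ν₀ : GM X} {Ω : Type w} [mΩ : MeasurableSpace Ω] {P : Measure Ω}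

/-- The observations. -/
def Z (D : SeqDesign τ ν₀ Ω P) (n : ℕ) (ω : Ω) : ℝ := obs τ D.ξ D.U D.pt n ω

/-- The `σ`-algebra `ℱ_n` generated by the first `n` design points and observations. -/
@[reducible] def sigma (D : SeqDesign τ ν₀ Ω P) (n : ℕ) : MeasurableSpace Ω := obsSigma τ D.ξ D.U D.pt n

/-- The `σ`-algebra `ℱ_∞` generated by all the design points and observations. -/
@[reducible] def sigmaInf (D : SeqDesign τ ν₀ Ω P) : MeasurableSpace Ω := ⨆ n, D.sigma n

lemma sigma_mono (D : SeqDesign τ ν₀ Ω P) : Monotone D.sigma := by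
  intro m n hmn
  exact iSup_mono fun i => iSup_mono' fun h => ⟨h.trans_le hmn, le_rfl⟩

lemma sigma_le (D : SeqDesign τ ν₀ Ω P) (n : ℕ) : D.sigma n ≤ mΩ := by
  induction n using Nat.strong_induction_on with
  | _ n ih =>
    refine iSup_le fun i => iSup_le fun hi => ?_
    have hpt : Measurable (D.pt i) := (D.measurable_pt i).mono (ih i hi) le_rfl
    refine sup_le hpt.comap_le (Measurable.comap_le ?_)
    have h1 : Measurable fun ω => D.ξ ω (D.pt i ω) := by
      have h : Continuous fun p : C(X, ℝ) × X => p.1 p.2 := ContinuousEval.continuous_eval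
      exact h.measurable.comp (D.measurable_ξ.prodMk hpt)
    have h2 : Measurable fun ω => (τ (D.pt i ω) : ℝ) :=
      ((NNReal.continuous_coe.comp τ.continuous).measurable).comp hpt
    exact h1.add (h2.mul (D.measurable_U i))

/-- The filtration `(ℱ_n)_{n ≥ 1}`. -/
def filtration (D : SeqDesign τ ν₀ Ω P) : Filtration ℕ+ mΩ where
  seq n := D.sigma n
  mono' _ _ h := D.sigma_mono h
  le' n := D.sigma_le n

/-- The posterior distribution `P_n^ξ = Cond_{X_1,Z_1,…,X_n,Z_n}(ν₀)`, the conditional distribution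
of `ξ` given `ℱ_n`, obtained by conditioning on the first `n` observations one after the other. -/
def posterior (D : SeqDesign τ ν₀ Ω P) : ℕ → Ω → GM X
  | 0, _ => ν₀
  | n + 1, ω => condPt τ (D.pt n ω) (D.Z n ω) (D.posterior n ω)

end SeqDesign

/-! ### Conditional distributions -/

section CondLaw

variable {Ω : Type w}

/-- `ν` is a Gaussian (regular) conditional distribution of `ξ` given the `σ`-algebra `m`. -/
structure IsCondLaw (m : MeasurableSpace Ω) {mΩ : MeasurableSpace Ω} (P : Measure Ω)
    (ξ : Ω → C(X, ℝ)) (ν : Ω → GM X) : Prop where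
  le : m ≤ mΩ
  measurable : Measurable[m] ν
  condProb : ∀ A : Set C(X, ℝ), MeasurableSet A →
    (fun ω => (ν ω).meas.real A) =ᵐ[P] P⟦ξ ⁻¹' A | m⟧

/-- The set of all Gaussian conditional distributions of `ξ`. -/
def condLaws {mΩ : MeasurableSpace Ω} (P : Measure Ω) (ξ : Ω → C(X, ℝ)) : Set (Ω → GM X) :=
  {ν | ∃ m : MeasurableSpace Ω, IsCondLaw m P ξ ν}

end CondLaw

/-! ### Properties of functionals of Gaussian measures -/

/-- The family of all `H(ν)`, `ν` a Gaussian conditional distribution of `ξ`, is uniformly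
integrable, for every Gaussian random element `ξ` of `C(X, ℝ)`. -/
def CondUniformIntegrable (H : GM X → ℝ) : Prop :=
  ∀ (Ω : Type w) [MeasurableSpace Ω] (P : Measure Ω) [IsProbabilityMeasure P] (ξ : Ω → C(X, ℝ)),
    Measurable ξ → IsGaussian (P.map ξ) →
      UniformIntegrable (fun (ν : condLaws P ξ) ω => H (ν.1 ω)) 1 P

/-- `H(ν_n) → H(ν_∞)` almost surely whenever `ν_n → ν_∞` almost surely, where the `ν_n` and `ν_∞`
are Gaussian conditional distributions of the same Gaussian random element `ξ` of `C(X, ℝ)`. -/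
def CondContinuous (H : GM X → ℝ) : Prop :=
  ∀ (Ω : Type w) [MeasurableSpace Ω] (P : Measure Ω) [IsProbabilityMeasure P] (ξ : Ω → C(X, ℝ)),
    Measurable ξ → IsGaussian (P.map ξ) →
      ∀ (ν : ℕ → Ω → GM X) (ν' : Ω → GM X), (∀ n, ν n ∈ condLaws P ξ) → ν' ∈ condLaws P ξ →
        (∀ᵐ ω ∂P, GM.TendstoGM (fun n => ν n ω) (ν' ω)) →
          ∀ᵐ ω ∂P, Tendsto (fun n => H (ν n ω)) atTop (𝓝 (H (ν' ω)))

/-- The supermartingale property: for every prior `ν₀` and every sequential design, the sequence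
`(H(P_n^ξ))_{n ≥ 1}` is a supermartingale with respect to `(ℱ_n)_{n ≥ 1}`. -/
def SupermartingaleProperty (τ : C(X, ℝ≥0)) (H : GM X → ℝ) : Prop :=
  ∀ (Ω : Type w) [MeasurableSpace Ω] (P : Measure Ω) [IsProbabilityMeasure P] (ν₀ : GM X)
    (D : SeqDesign τ ν₀ Ω P),
      Supermartingale (fun (n : ℕ+) ω => H (D.posterior n ω)) D.filtration P

/-! ### The sampling criterion, quasi-SUR designs and the maximal expected gain -/

/-- The sampling criterion
`𝒥_x(ν) = ∫∫ H(Cond_{x, f(x) + u τ(x)}(ν)) ν(df) φ(u) du ∈ [0, ∞]`. -/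
def crit (τ : C(X, ℝ≥0)) (H : GM X → ℝ≥0) (x : X) (ν : GM X) : ℝ≥0∞ :=
  ∫⁻ f, ∫⁻ u, (H (condPt τ x (f x + u * τ x) ν) : ℝ≥0∞) ∂(gaussianReal 0 1) ∂ν.meas

/-- The expected gain `𝒢_x(ν) = H(ν) - 𝒥_x(ν)`. -/
def gain (τ : C(X, ℝ≥0)) (H : GM X → ℝ≥0) (x : X) (ν : GM X) : EReal :=
  ((H ν : ℝ≥0∞) : EReal) - (crit τ H x ν : EReal)

/-- The maximal expected gain `𝒢(ν) = sup_x 𝒢_x(ν)`. -/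
def maxGain (τ : C(X, ℝ≥0)) (H : GM X → ℝ≥0) (ν : GM X) : EReal := ⨆ x, gain τ H x ν

/-- `D` is a quasi-SUR design for `H`: for some sequence `ε_n → 0` of positive real numbers and some
integer `n₀`, `J_n(X_{n+1}) ≤ inf J_n + ε_n` almost surely for all `n ≥ n₀`, where
`J_n(x) = 𝒥_x(P_n^ξ)`. -/
def SeqDesign.IsQuasiSUR {τ : C(X, ℝ≥0)} {ν₀ : GM X} {Ω : Type w} [MeasurableSpace Ω]
    {P : Measure Ω} (D : SeqDesign τ ν₀ Ω P) (H : GM X → ℝ≥0) : Prop :=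
  ∃ ε : ℕ → ℝ, (∀ n, 0 < ε n) ∧ Tendsto ε atTop (𝓝 0) ∧ ∃ n₀ : ℕ, ∀ n ≥ n₀, ∀ᵐ ω ∂P,
    crit τ H (D.pt n ω) (D.posterior n ω) ≤
      (⨅ x, crit τ H x (D.posterior n ω)) + ENNReal.ofReal (ε n)

end

end SUR

namespace SUR

noncomputable section

variable {X : Type u} [MetricSpace X] [CompactSpace X]

/-! ### Measurability -/

/-! Write P_n for the posterior given ℱ_n, P_∞ for the limit, and J_x for the criterion. The core
claim is that E[H(P_∞); S] = E[J_x(P_∞); S] for every point x and every S in some ℱ_k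
(`setLIntegral_crit_eq`).

Lower bound on H: the design that follows the given one up to time n and then observes at x is again
sequential, so the supermartingale property gives E[J_x(P_n); S] ≤ E[H(P_n); S]. Upper bound:
E[H(P_{n+1})] = E[J_{X_{n+1}}(P_n)] ≤ E[J_x(P_n)] + ε_n by the quasi-SUR property. On the complement
of S, J_x is bounded by H again, and that part cancels in the limit.

Both limits n → ∞ rest on one principle (`IsDecomposition.tendsto_setLIntegral`). The integral of H₀
over S is E[L₀(ξ); S], which does not depend on n. The H₁ part converges by Vitali's theorem,
because Lévy's upward theorem in C(X) and C(X × X) makes means and covariances converge uniformly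
(`IsCondLaw.ae_tendstoGM`). For J_x the principle is applied after enlarging the space by a fresh
noise variable: J_x(P_n) is then the conditional expectation of H at the posterior that uses one
more observation at x, and the enlarged σ-algebras still increase to their limit
(`tendsto_setLIntegral_crit`).

A π-system argument yields J_x(P_∞) = H(P_∞) almost surely for fixed x, hence simultaneously on a
countable dense set. For a fixed Gaussian measure, J_x is continuous in x wherever the predictive
variance is nonzero (`tendsto_crit`), and equals H elsewhere, so equality holds at all x and every
gain vanishes.

Two facts support this. The operator `condPt` really is conditioning, since residual and observation
are jointly Gaussian and uncorrelated (`indepFun_resid_obs`). The limit P_∞ exists as a Gaussian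
law, since Gaussianity amounts to square integrability and countably many identities that survive
the limit (`ae_isGaussian_condDistrib`). -/

lemma measurable_continuousMap_iff {α : Type*} [MeasurableSpace α] {F : α → C(X, ℝ)} :
    Measurable F ↔ ∀ x, Measurable fun a => F a x := by
  have hev : ∀ x : X, Measurable fun f : C(X, ℝ) => f x := fun x =>
    (ContinuousMap.evalCLM ℝ x).continuous.measurable
  refine ⟨fun h x => (hev x).comp h, fun h => ?_⟩
  rcases isEmpty_or_nonempty X with hX | hX
  · have : Subsingleton C(X, ℝ) := ⟨fun f g => by ext x; exact hX.elim x⟩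
    exact measurable_of_subsingleton_codomain _
  let Φ : C(X, ℝ) → (ℕ → ℝ) := fun f j => f (TopologicalSpace.denseSeq X j)
  have hΦc : Continuous Φ :=
    continuous_pi fun j => (ContinuousMap.evalCLM ℝ (TopologicalSpace.denseSeq X j)).continuous
  have hΦi : Function.Injective Φ := by
    intro f g hfg
    have := (TopologicalSpace.denseRange_denseSeq X).equalizer f.continuous g.continuous
      (by ext j; exact congrFun hfg j)
    exact DFunLike.coe_injective this
  -- By Lusin–Souslin, a continuous injection between Polish spaces is a measurable embedding, so
  -- countably many evaluations generate the Borel σ-algebra.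
  rw [← (hΦc.measurableEmbedding hΦi).measurable_comp_iff]
  exact measurable_pi_lambda _ fun j => h _

lemma GM.measurable_meas : Measurable (GM.meas : GM X → Measure C(X, ℝ)) := measurable_subtype_coe

variable (X) in
/-- The kernel from the space of Gaussian measures given by the measures themselves. -/
def GM.kernel : Kernel (GM X) C(X, ℝ) := ⟨GM.meas, GM.measurable_meas⟩

instance : IsMarkovKernel (GM.kernel X) := ⟨fun ν => inferInstanceAs (IsProbabilityMeasure ν.meas)⟩

lemma measurable_gm_iff {α : Type*} [MeasurableSpace α] {ν : α → GM X} :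
    Measurable ν ↔ ∀ A : Set C(X, ℝ), MeasurableSet A → Measurable fun a => (ν a).meas A := by
  refine ⟨fun h A hA => (Measure.measurable_coe hA).comp (GM.measurable_meas.comp h), fun h => ?_⟩
  exact Measurable.subtype_mk (Measure.measurable_of_measurable_coe _ h)

lemma GM.measurable_lintegral {α : Type*} [MeasurableSpace α] {g : α → C(X, ℝ) → ℝ≥0∞}
    (hg : Measurable (Function.uncurry g)) {ν : α → GM X} (hν : Measurable ν) :
    Measurable fun a => ∫⁻ f, g a f ∂(ν a).meas := by
  let K : Kernel α C(X, ℝ) := (GM.kernel X).comap ν hν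
  exact hg.lintegral_kernel_prod_right (κ := K)

lemma GM.measurable_integral {α : Type*} [MeasurableSpace α] {g : α → C(X, ℝ) → ℝ}
    (hg : Measurable (Function.uncurry g)) {ν : α → GM X} (hν : Measurable ν) :
    Measurable fun a => ∫ f, g a f ∂(ν a).meas := by
  let K : Kernel α C(X, ℝ) := (GM.kernel X).comap ν hν
  exact (hg.stronglyMeasurable.integral_kernel_prod_right' (κ := K)).measurable

lemma GM.cov_eq (ν : GM X) (x y : X) :
    ν.cov x y = ∫ f, f x * f y ∂ν.meas - ν.mean x * ν.mean y := by
  unfold GM.cov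
  rw [covariance_eq_sub (ν.memLp_eval x) (ν.memLp_eval y)]
  rfl

section

variable [MeasurableSpace X] [BorelSpace X]

lemma measurable_continuousMap_eval : Measurable fun p : C(X, ℝ) × X => p.1 p.2 :=
  (ContinuousEval.continuous_eval (F := C(X, ℝ))).measurable

lemma measurable_noise (τ : C(X, ℝ≥0)) : Measurable fun x => (τ x : ℝ) :=
  (NNReal.continuous_coe.comp τ.continuous).measurable

lemma GM.measurable_mean : Measurable fun p : GM X × X => p.1.mean p.2 := by
  unfold GM.mean
  refine GM.measurable_integral (g := fun (p : GM X × X) f => f p.2) ?_ measurable_fst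
  exact measurable_continuousMap_eval.comp
    (measurable_snd.prodMk (measurable_snd.comp measurable_fst))

lemma GM.measurable_cov : Measurable fun p : GM X × X × X => p.1.cov p.2.1 p.2.2 := by
  simp_rw [GM.cov_eq]
  refine Measurable.sub ?_ (Measurable.mul ?_ ?_)
  · refine GM.measurable_integral (g := fun (p : GM X × X × X) f => f p.2.1 * f p.2.2) ?_
      measurable_fst
    refine Measurable.mul ?_ ?_
    · exact measurable_continuousMap_eval.comp (measurable_snd.prodMk (by fun_prop))
    · exact measurable_continuousMap_eval.comp (measurable_snd.prodMk (by fun_prop))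
  · exact GM.measurable_mean.comp (f := fun p : GM X × X × X => (p.1, p.2.1)) (by fun_prop)
  · exact GM.measurable_mean.comp (f := fun p : GM X × X × X => (p.1, p.2.2)) (by fun_prop)

lemma measurable_predVar (τ : C(X, ℝ≥0)) : Measurable fun p : X × GM X => predVar τ p.2 p.1 := by
  unfold predVar
  refine Measurable.add ?_ (((measurable_noise τ).comp measurable_fst).pow_const 2)
  exact GM.measurable_cov.comp (f := fun p : X × GM X => (p.2, p.1, p.1)) (by fun_prop)

lemma measurable_gainFun (τ : C(X, ℝ≥0)) : Measurable fun p : X × GM X => gainFun τ p.2 p.1 := by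
  rw [measurable_continuousMap_iff]
  intro y
  refine Measurable.div ?_ (measurable_predVar τ)
  exact GM.measurable_cov.comp (f := fun p : X × GM X => (p.2, y, p.1)) (by fun_prop)

lemma measurable_condMap (τ : C(X, ℝ≥0)) :
    Measurable fun p : (X × ℝ × GM X) × (C(X, ℝ) × ℝ) =>
      condMap τ p.1.1 p.1.2.1 p.1.2.2 p.2 := by
  unfold condMap
  have h1 : Measurable fun p : (X × ℝ × GM X) × (C(X, ℝ) × ℝ) => p.2.1 p.1.1 :=
    measurable_continuousMap_eval.comp
      (f := fun p : (X × ℝ × GM X) × (C(X, ℝ) × ℝ) => (p.2.1, p.1.1)) (by fun_prop)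
  have h2 : Measurable fun p : (X × ℝ × GM X) × (C(X, ℝ) × ℝ) => gainFun τ p.1.2.2 p.1.1 :=
    (measurable_gainFun τ).comp
      (f := fun p : (X × ℝ × GM X) × (C(X, ℝ) × ℝ) => (p.1.1, p.1.2.2)) (by fun_prop)
  have h3 : Measurable fun p : (X × ℝ × GM X) × (C(X, ℝ) × ℝ) => (τ p.1.1 : ℝ) :=
    (measurable_noise τ).comp (by fun_prop)
  have h4 : Measurable fun p : (X × ℝ × GM X) × (C(X, ℝ) × ℝ) =>
      p.1.2.1 - p.2.1 p.1.1 - τ p.1.1 * p.2.2 :=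
    (Measurable.sub (by fun_prop) h1).sub (h3.mul (by fun_prop))
  have h5 := h4.smul h2
  exact Measurable.add (by fun_prop) h5

lemma measurable_condPt (τ : C(X, ℝ≥0)) :
    Measurable fun p : X × ℝ × GM X => condPt τ p.1 p.2.1 p.2.2 := by
  rw [measurable_gm_iff]
  intro A hA
  let K : Kernel (X × ℝ × GM X) (C(X, ℝ) × ℝ) :=
    ((GM.kernel X).comap (fun p : X × ℝ × GM X => p.2.2) (by fun_prop)) ×ₖ
      Kernel.const _ (gaussianReal 0 1)
  have h : ∀ p : X × ℝ × GM X, (condPt τ p.1 p.2.1 p.2.2).meas A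
      = K p (Prod.mk p ⁻¹' ((fun q : (X × ℝ × GM X) × (C(X, ℝ) × ℝ) =>
        condMap τ q.1.1 q.1.2.1 q.1.2.2 q.2) ⁻¹' A)) := by
    intro p
    have : K p = p.2.2.meas.prod (gaussianReal 0 1) := by
      simp only [K, Kernel.prod_apply, Kernel.comap_apply, Kernel.const_apply]
      rfl
    rw [this]
    exact Measure.map_apply (continuous_condMap τ p.1 p.2.1 p.2.2).measurable hA
  simp_rw [h]
  exact Kernel.measurable_kernel_prodMk_left (measurable_condMap τ hA)

lemma measurable_crit (τ : C(X, ℝ≥0)) {H : GM X → ℝ≥0} (hH : Measurable H) :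
    Measurable fun p : X × GM X => crit τ H p.1 p.2 := by
  unfold crit
  refine GM.measurable_lintegral
    (g := fun (p : X × GM X) f =>
      ∫⁻ u, (H (condPt τ p.1 (f p.1 + u * τ p.1) p.2) : ℝ≥0∞) ∂(gaussianReal 0 1)) ?_ measurable_snd
  refine Measurable.lintegral_prod_right' (f := fun q : ((X × GM X) × C(X, ℝ)) × ℝ =>
    (H (condPt τ q.1.1.1 (q.1.2 q.1.1.1 + q.2 * τ q.1.1.1) q.1.1.2) : ℝ≥0∞)) ?_
  refine (hH.comp ?_).coe_nnreal_ennreal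
  refine (measurable_condPt τ).comp (f := fun q : ((X × GM X) × C(X, ℝ)) × ℝ =>
    (q.1.1.1, q.1.2 q.1.1.1 + q.2 * τ q.1.1.1, q.1.1.2)) ?_
  have h1 : Measurable fun q : ((X × GM X) × C(X, ℝ)) × ℝ => q.1.2 q.1.1.1 :=
    measurable_continuousMap_eval.comp
      (f := fun q : ((X × GM X) × C(X, ℝ)) × ℝ => (q.1.2, q.1.1.1)) (by fun_prop)
  have h2 : Measurable fun q : ((X × GM X) × C(X, ℝ)) × ℝ => (τ q.1.1.1 : ℝ) :=
    (measurable_noise τ).comp (by fun_prop)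
  exact Measurable.prodMk (by fun_prop) ((h1.add (measurable_snd.mul h2)).prodMk (by fun_prop))

end

/-! ### Conditional distributions as disintegrations -/

section Disintegration

variable {Ω β : Type*} [MeasurableSpace β] {mΩ : MeasurableSpace Ω} {P : Measure Ω}
  [IsProbabilityMeasure P] {ξ : Ω → C(X, ℝ)} {Y : Ω → β} {η : β → GM X}

/-- Hypothesis `h` is the integrated form of "η(Y) is the conditional law of ξ given Y".
Conditioning on a σ-algebra `m` is the case where `Y` is the identity map into Ω equipped with `m`;
this explains the explicit measurable spaces in later uses. -/
lemma map_prodMk_eq_compProd (hξ : Measurable ξ) (hY : Measurable Y) (hη : Measurable η)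
    (h : ∀ S, MeasurableSet S → ∀ A, MeasurableSet A →
      ∫⁻ ω in Y ⁻¹' S, (η (Y ω)).meas A ∂P = P (Y ⁻¹' S ∩ ξ ⁻¹' A)) :
    P.map (fun ω => (Y ω, ξ ω)) = P.map Y ⊗ₘ (GM.kernel X).comap η hη := by
  have : IsProbabilityMeasure (P.map Y) := Measure.isProbabilityMeasure_map hY.aemeasurable
  refine Measure.ext_prod fun {S A} hS hA => ?_
  rw [Measure.compProd_apply_prod hS hA, Measure.map_apply (hY.prodMk hξ) (hS.prod hA),
    Set.mk_preimage_prod, ← h S hS A hA, setLIntegral_map hS _ hY]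
  · rfl
  · exact Kernel.measurable_coe _ hA

lemma lintegral_disintegration (hξ : Measurable ξ) (hY : Measurable Y) (hη : Measurable η)
    (h : ∀ S, MeasurableSet S → ∀ A, MeasurableSet A →
      ∫⁻ ω in Y ⁻¹' S, (η (Y ω)).meas A ∂P = P (Y ⁻¹' S ∩ ξ ⁻¹' A))
    {G : β × C(X, ℝ) → ℝ≥0∞} (hG : Measurable G) :
    ∫⁻ ω, G (Y ω, ξ ω) ∂P = ∫⁻ ω, ∫⁻ f, G (Y ω, f) ∂(η (Y ω)).meas ∂P := by
  have : IsProbabilityMeasure (P.map Y) := Measure.isProbabilityMeasure_map hY.aemeasurable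
  rw [← lintegral_map hG (hY.prodMk hξ), map_prodMk_eq_compProd hξ hY hη h,
    Measure.lintegral_compProd hG, lintegral_map _ hY]
  · rfl
  · exact hG.lintegral_kernel_prod_right' (κ := (GM.kernel X).comap η hη)

lemma ae_eq_condDistrib (hξ : Measurable ξ) (hY : Measurable Y) (hη : Measurable η)
    (h : ∀ S, MeasurableSet S → ∀ A, MeasurableSet A →
      ∫⁻ ω in Y ⁻¹' S, (η (Y ω)).meas A ∂P = P (Y ⁻¹' S ∩ ξ ⁻¹' A)) :
    ∀ᵐ ω ∂P, (η (Y ω)).meas = condDistrib ξ Y P (Y ω) := by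
  have := condDistrib_ae_eq_of_measure_eq_compProd Y hξ.aemeasurable
    (map_prodMk_eq_compProd hξ hY hη h)
  filter_upwards [ae_of_ae_map hY.aemeasurable this] with ω hω
  rw [hω]; rfl

end Disintegration

section IsCondLaw

variable {Ω : Type*} {m mΩ : MeasurableSpace Ω} {P : Measure Ω}
  [IsProbabilityMeasure P] {ξ : Ω → C(X, ℝ)} {ν : Ω → GM X}

lemma IsCondLaw.measurable' (h : IsCondLaw m P ξ ν) : Measurable ν := h.measurable.mono h.le le_rfl

lemma measurable_meas_apply {ν : Ω → GM X} (hν : Measurable[m] ν) {A : Set C(X, ℝ)}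
    (hA : MeasurableSet A) : Measurable[m] fun ω => (ν ω).meas A :=
  (Measure.measurable_coe hA).comp (GM.measurable_meas.comp hν)

lemma IsCondLaw.setLIntegral (h : IsCondLaw m P ξ ν) (hξ : Measurable ξ) {S : Set Ω}
    (hS : MeasurableSet[m] S) {A : Set C(X, ℝ)} (hA : MeasurableSet A) :
    ∫⁻ ω in S, (ν ω).meas A ∂P = P (S ∩ ξ ⁻¹' A) := by
  have h1 : ∫ ω in S, (ν ω).meas.real A ∂P = P.real (S ∩ ξ ⁻¹' A) := by
    rw [setIntegral_congr_ae (h.le _ hS) ((h.condProb A hA).mono fun ω hω _ => hω),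
      setIntegral_condExp h.le ((integrable_const _).indicator (hξ hA)) hS,
      integral_indicator_const _ (hξ hA), measureReal_restrict_apply (hξ hA), Set.inter_comm]
    simp
  have hm := measurable_meas_apply h.measurable' hA
  have h2 : ∫⁻ ω in S, (ν ω).meas A ∂P ≠ ∞ := by
    refine ((lintegral_mono (g := fun _ => 1) fun ω => prob_le_one).trans_lt ?_).ne
    simp [measure_lt_top]
  rw [← ENNReal.ofReal_toReal h2, ← integral_toReal hm.aemeasurable
    (Eventually.of_forall fun ω => measure_lt_top _ _)]
  simp_rw [← measureReal_def]
  rw [h1, ofReal_measureReal]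

lemma isCondLaw_of_setLIntegral (hm : m ≤ mΩ) (hξ : Measurable ξ) (hν : Measurable[m] ν)
    (h : ∀ S, MeasurableSet[m] S → ∀ A, MeasurableSet A →
      ∫⁻ ω in S, (ν ω).meas A ∂P = P (S ∩ ξ ⁻¹' A)) : IsCondLaw m P ξ ν := by
  refine ⟨hm, hν, fun A hA => ?_⟩
  have hmA := measurable_meas_apply hν hA
  have hmA' := measurable_meas_apply (hν.mono hm le_rfl) hA
  have hint : Integrable (fun ω => (ν ω).meas.real A) P :=
    Integrable.of_bound hmA'.ennreal_toReal.aestronglyMeasurable 1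
      (Eventually.of_forall fun ω => by
        rw [Real.norm_of_nonneg measureReal_nonneg]; exact measureReal_le_one)
  refine ae_eq_condExp_of_forall_setIntegral_eq hm ((integrable_const _).indicator (hξ hA))
    (fun _ _ _ => hint.integrableOn) (fun S hS _ => ?_)
    hmA.ennreal_toReal.aestronglyMeasurable
  rw [integral_indicator_const _ (hξ hA), measureReal_restrict_apply (hξ hA), Set.inter_comm]
  simp only [measureReal_def, smul_eq_mul, mul_one]
  rw [integral_toReal hmA'.aemeasurable (Eventually.of_forall fun ω => measure_lt_top _ _),
    h S hS A hA]

lemma IsCondLaw.ae_eq_condDistrib (h : IsCondLaw m P ξ ν) (hξ : Measurable ξ) :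
    ∀ᵐ ω ∂P, (ν ω).meas = @condDistrib Ω Ω C(X, ℝ) _ _ _ mΩ m ξ id P _ ω :=
  @SUR.ae_eq_condDistrib X _ _ Ω Ω m mΩ P _ ξ id ν hξ (measurable_id'' h.le) h.measurable
    (fun _ hS _ hA => h.setLIntegral hξ hS hA)

lemma condExp_ae_eq_integral_condDistrib_of_le {F : Type*} [NormedAddCommGroup F] [NormedSpace ℝ F]
    [CompleteSpace F] (hm : m ≤ mΩ) (hξ : Measurable ξ) {g : C(X, ℝ) → F} (hg : StronglyMeasurable g)
    (hint : Integrable (fun ω => g (ξ ω)) P) :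
    P[fun ω => g (ξ ω) | m] =ᵐ[P]
      fun ω => ∫ f, g f ∂(@condDistrib Ω Ω C(X, ℝ) _ _ _ mΩ m ξ id P _ ω) := by
  have := @condExp_ae_eq_integral_condDistrib Ω Ω C(X, ℝ) F _ _ _ _ mΩ P _ id ξ m _ _
    (measurable_id'' hm) hξ.aemeasurable g hg hint
  rwa [MeasurableSpace.comap_id] at this

lemma IsCondLaw.condExp_ae_eq {F : Type*} [NormedAddCommGroup F] [NormedSpace ℝ F]
    [CompleteSpace F] (h : IsCondLaw m P ξ ν) (hξ : Measurable ξ) {g : C(X, ℝ) → F}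
    (hg : StronglyMeasurable g) (hint : Integrable (fun ω => g (ξ ω)) P) :
    P[fun ω => g (ξ ω) | m] =ᵐ[P] fun ω => ∫ f, g f ∂(ν ω).meas := by
  filter_upwards [condExp_ae_eq_integral_condDistrib_of_le h.le hξ hg hint,
    h.ae_eq_condDistrib hξ] with ω h1 h2
  rw [h1, h2]

end IsCondLaw

/-! ### Lévy's upward theorem in separable Banach spaces -/

/-- Reduction to the scalar theorem: for `d j` in a dense sequence, ‖E[h | ℱ_n] - d_j‖ ≤ E[‖h - d_j‖
| ℱ_n], and the right side tends to ‖h - d_j‖, which is small for a suitable j. -/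
theorem tendsto_ae_condExp_of_separable {Ω E : Type*} {mΩ : MeasurableSpace Ω} {P : Measure Ω}
    [IsFiniteMeasure P] [NormedAddCommGroup E] [NormedSpace ℝ E] [CompleteSpace E]
    [TopologicalSpace.SeparableSpace E] (ℱ : Filtration ℕ mΩ) (g : Ω → E) :
    ∀ᵐ ω ∂P, Tendsto (fun n => (P[g | ℱ n]) ω) atTop (𝓝 ((P[g | ⨆ n, ℱ n]) ω)) := by
  set h := P[g | ⨆ n, ℱ n] with hh
  have hle : ⨆ n, ℱ n ≤ mΩ := iSup_le ℱ.le
  have hint : Integrable h P := integrable_condExp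
  have hsm : StronglyMeasurable[⨆ n, ℱ n] h := stronglyMeasurable_condExp
  let d := TopologicalSpace.denseSeq E
  have h1 : ∀ n, P[g | ℱ n] =ᵐ[P] P[h | ℱ n] := fun n =>
    (condExp_condExp_of_le (le_iSup ℱ.seq n) hle).symm
  have h2 : ∀ n j, ∀ᵐ ω ∂P, ‖(P[h | ℱ n]) ω - d j‖ ≤ (P[fun ω => ‖h ω - d j‖ | ℱ n]) ω := by
    intro n j
    have h3 := condExp_sub hint (integrable_const (d j)) (m := ℱ n)
    rw [condExp_const (ℱ.le n)] at h3
    have h4 := norm_condExp_le (μ := P) (m := ℱ n) (h - fun _ => d j)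
    filter_upwards [h3, h4] with ω h5 h6
    rw [h5] at h6
    exact h6
  have h3 : ∀ j, ∀ᵐ ω ∂P, Tendsto (fun n => (P[fun ω => ‖h ω - d j‖ | ℱ n]) ω) atTop
      (𝓝 ‖h ω - d j‖) := fun j =>
    ((hint.sub (integrable_const _)).norm).tendsto_ae_condExp
      (hsm.sub stronglyMeasurable_const).norm
  filter_upwards [ae_all_iff.2 h1, ae_all_iff.2 fun n => ae_all_iff.2 (h2 n), ae_all_iff.2 h3]
    with ω h1 h2 h3
  rw [Metric.tendsto_atTop']
  intro ε hε
  obtain ⟨j, hj⟩ := (TopologicalSpace.denseRange_denseSeq E).exists_dist_lt (h ω)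
    (show 0 < ε / 2 by positivity)
  rw [dist_eq_norm] at hj
  obtain ⟨N, hN⟩ := eventually_atTop.1 ((h3 j).eventually_lt_const hj)
  refine ⟨N, fun n hn => ?_⟩
  rw [h1 n, dist_eq_norm]
  calc ‖(P[h | ℱ n]) ω - h ω‖ ≤ ‖(P[h | ℱ n]) ω - d j‖ + ‖d j - h ω‖ := norm_sub_le_norm_sub_add_norm_sub _ _ _
    _ < ε / 2 + ε / 2 := by
      rw [norm_sub_rev (d j)]
      exact add_lt_add ((h2 n j).trans_lt (hN n hn.le)) hj
    _ = ε := by ring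

/-! ### First and second moments as continuous functions -/

/-- The function `(x, y) ↦ f x * f y`. -/
def tensorSq (f : C(X, ℝ)) : C(X × X, ℝ) := f.comp ContinuousMap.fst * f.comp ContinuousMap.snd

lemma continuous_tensorSq : Continuous (tensorSq : C(X, ℝ) → C(X × X, ℝ)) := by
  unfold tensorSq
  exact (ContinuousMap.continuous_precomp _).mul (ContinuousMap.continuous_precomp _)

lemma norm_tensorSq_le (f : C(X, ℝ)) : ‖tensorSq f‖ ≤ ‖f‖ ^ 2 := by
  rw [ContinuousMap.norm_le _ (by positivity)]
  intro p
  simp only [tensorSq, ContinuousMap.mul_apply, norm_mul, sq]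
  exact mul_le_mul (f.norm_coe_le_norm _) (f.norm_coe_le_norm _) (norm_nonneg _) (norm_nonneg _)

lemma integrable_tensorSq {Ω : Type*} [MeasurableSpace Ω] {P : Measure Ω} {ξ : Ω → C(X, ℝ)}
    (hξ : MemLp ξ 2 P) : Integrable (fun ω => tensorSq (ξ ω)) P :=
  hξ.integrable_norm_pow (by simp) |>.mono'
    (continuous_tensorSq.comp_aestronglyMeasurable hξ.1)
    (Eventually.of_forall fun _ => norm_tensorSq_le _)

lemma GM.memLp_id (ν : GM X) : MemLp (fun f : C(X, ℝ) => f) 2 ν.meas := IsGaussian.memLp_two_id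

/-- The mean function, as a continuous function. -/
def GM.meanC (ν : GM X) : C(X, ℝ) := ∫ f, f ∂ν.meas

/-- The second moment function, as a continuous function. -/
def GM.momentC (ν : GM X) : C(X × X, ℝ) := ∫ f, tensorSq f ∂ν.meas

lemma GM.meanC_apply (ν : GM X) (x : X) : ν.meanC x = ν.mean x :=
  ((ContinuousMap.evalCLM ℝ x).integral_comp_comm (ν.memLp_id.integrable one_le_two)).symm

lemma GM.momentC_apply (ν : GM X) (x y : X) : ν.momentC (x, y) = ∫ f, f x * f y ∂ν.meas :=
  ((ContinuousMap.evalCLM ℝ (x, y)).integral_comp_comm (integrable_tensorSq ν.memLp_id)).symm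

/-- The covariance function, as a continuous function. -/
def GM.covC (ν : GM X) : C(X × X, ℝ) := ν.momentC - tensorSq ν.meanC

lemma GM.covC_apply (ν : GM X) (x y : X) : ν.covC (x, y) = ν.cov x y := by
  simp [covC, tensorSq, momentC_apply, meanC_apply, cov_eq]

/-- Recasts the two uniform convergences as norm convergence in Banach spaces, the form in which the
vector-valued Lévy theorem delivers them. -/
lemma tendstoGM_iff {ν : ℕ → GM X} {ν' : GM X} : GM.TendstoGM ν ν' ↔
    Tendsto (fun n => (ν n).meanC) atTop (𝓝 ν'.meanC) ∧
      Tendsto (fun n => (ν n).covC) atTop (𝓝 ν'.covC) := by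
  rw [ContinuousMap.tendsto_iff_tendstoUniformly, ContinuousMap.tendsto_iff_tendstoUniformly]
  have h1 : ∀ ν : GM X, (ν.meanC : X → ℝ) = ν.mean := fun ν => funext ν.meanC_apply
  have h2 : ∀ ν : GM X, (ν.covC : X × X → ℝ) = fun p => ν.cov p.1 p.2 :=
    fun ν => funext fun p => ν.covC_apply p.1 p.2
  simp_rw [h1, h2]
  rfl

/-! ### A countable characterization of Gaussian measures -/

section Dual

variable (E : Type*) [NormedAddCommGroup E] [NormedSpace ℝ E]
  [TopologicalSpace.SeparableSpace E]

/-- Balls of the dual are weak-* compact (Banach–Alaoglu) and metrizable because `E` is separable,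
hence separable; a dense sequence is taken in each ball of integer radius. The bound `C` serves
dominated convergence. -/
lemma exists_countable_dense_strongDual : ∃ L : ℕ × ℕ → StrongDual ℝ E,
    ∀ ℓ : StrongDual ℝ E, ∃ (C : ℝ) (σ : ℕ → ℕ × ℕ), (∀ n, ‖L (σ n)‖ ≤ C) ∧
      ∀ f, Tendsto (fun n => L (σ n) f) atTop (𝓝 (ℓ f)) := by
  let K : ℕ → Set (WeakDual ℝ E) := fun k => WeakDual.toStrongDual ⁻¹' Metric.closedBall 0 k
  have hK : ∀ k, IsCompact (K k) := fun k => WeakDual.isCompact_closedBall 0 k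
  have hmet : ∀ k, TopologicalSpace.MetrizableSpace (K k) := fun k =>
    WeakDual.metrizable_of_isCompact ℝ E _ (hK k)
  have hcs : ∀ k, CompactSpace (K k) := fun k => isCompact_iff_compactSpace.1 (hK k)
  have hne : ∀ k, Nonempty (K k) := fun k => ⟨⟨0, by simp [K]⟩⟩
  have hsep : ∀ k, TopologicalSpace.SeparableSpace (K k) := fun k => by
    let := TopologicalSpace.metrizableSpaceMetric (K k)
    infer_instance
  refine ⟨fun p => WeakDual.toStrongDual (TopologicalSpace.denseSeq (K p.1) p.2 : WeakDual ℝ E), fun ℓ => ?_⟩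
  obtain ⟨k, hk⟩ := exists_nat_ge ‖ℓ‖
  let ℓ' : K k := ⟨StrongDual.toWeakDual ℓ, by simpa [K] using hk⟩
  have hcl : ℓ' ∈ closure (Set.range (TopologicalSpace.denseSeq (K k))) :=
    TopologicalSpace.denseRange_denseSeq (K k) ℓ'
  obtain ⟨s, hs, hs'⟩ := mem_closure_iff_seq_limit.1 hcl
  choose j hj using hs
  refine ⟨k, fun n => (k, j n), fun n => ?_, fun f => ?_⟩
  · have := (TopologicalSpace.denseSeq (K k) (j n)).2
    exact mem_closedBall_zero_iff.1 this
  · have h1 : Tendsto (fun n => (s n : WeakDual ℝ E)) atTop (𝓝 (ℓ' : WeakDual ℝ E)) :=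
      (continuous_subtype_val.tendsto _).comp hs'
    have h2 := ((WeakDual.eval_continuous f).tendsto _).comp h1
    simp only [hj]
    exact h2

end Dual

section Gaussian

variable {E : Type*} [NormedAddCommGroup E] [NormedSpace ℝ E] [MeasurableSpace E] [BorelSpace E]

/-- The characteristic function of a Gaussian distribution on `ℝ` at `1`, as a function of its
first two moments. -/
def gaussianChar (a b : ℝ) : ℂ := Complex.exp (a * Complex.I - (b - a ^ 2) / 2)

lemma continuous_gaussianChar : Continuous fun p : ℝ × ℝ => gaussianChar p.1 p.2 := by
  unfold gaussianChar
  fun_prop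

lemma gaussian_identity_iff (μ : Measure E) [IsProbabilityMeasure μ] (hμ : MemLp id 2 μ)
    (L : StrongDual ℝ E) :
    charFunDual μ L = Complex.exp ((μ[L] : ℝ) * Complex.I - (Var[L; μ] : ℝ) / 2) ↔
      ∫ f, Complex.exp (L f * Complex.I) ∂μ = gaussianChar (∫ f, L f ∂μ) (∫ f, L f ^ 2 ∂μ) := by
  have hL : MemLp L 2 μ := L.comp_memLp' hμ
  rw [charFunDual_apply, gaussianChar, variance_eq_sub hL]
  simp

/-- All three integrals pass to the limit along norm-bounded, pointwise convergent functionals, with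
dominating functions 1, C‖f‖ and C²‖f‖². Countably many identities therefore suffice, which makes
Gaussianity both a measurable condition and one that can be checked almost surely. -/
lemma isGaussian_iff_of_dense [CompleteSpace E] [SecondCountableTopology E] {ι : Type*}
    {L : ι → StrongDual ℝ E}
    (hL : ∀ ℓ : StrongDual ℝ E, ∃ (C : ℝ) (σ : ℕ → ι), (∀ n, ‖L (σ n)‖ ≤ C) ∧
      ∀ f, Tendsto (fun n => L (σ n) f) atTop (𝓝 (ℓ f)))
    (μ : Measure E) [IsProbabilityMeasure μ] :
    IsGaussian μ ↔ MemLp id 2 μ ∧ ∀ i, ∫ f, Complex.exp (L i f * Complex.I) ∂μ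
      = gaussianChar (∫ f, L i f ∂μ) (∫ f, L i f ^ 2 ∂μ) := by
  constructor
  · intro h
    have h2 : MemLp id 2 μ := IsGaussian.memLp_two_id
    refine ⟨h2, fun i => (gaussian_identity_iff μ h2 _).1 ?_⟩
    rw [h.charFunDual_eq, integral_complex_ofReal]
  · rintro ⟨h2, h⟩
    rw [isGaussian_iff_charFunDual_eq]
    intro ℓ
    rw [integral_complex_ofReal]
    refine (gaussian_identity_iff μ h2 _).2 ?_
    obtain ⟨C, σ, hC, hσ⟩ := hL ℓ
    have hb : ∀ n f, |L (σ n) f| ≤ C * ‖f‖ := fun n f =>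
      ((L (σ n)).le_opNorm f).trans (by gcongr; exact hC n)
    have t1 : Tendsto (fun n => ∫ f, Complex.exp (L (σ n) f * Complex.I) ∂μ) atTop
        (𝓝 (∫ f, Complex.exp (ℓ f * Complex.I) ∂μ)) := by
      refine tendsto_integral_of_dominated_convergence (fun _ => 1) (fun n => ?_)
        (integrable_const _) (fun n => ?_) ?_
      · exact Continuous.aestronglyMeasurable (by fun_prop)
      · exact Eventually.of_forall fun f => by rw [Complex.norm_exp_ofReal_mul_I]
      · refine Eventually.of_forall fun f => ?_
        have : Continuous fun x : ℝ => Complex.exp (x * Complex.I) := by fun_prop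
        exact (this.tendsto _).comp (hσ f)
    have t2 : Tendsto (fun n => ∫ f, L (σ n) f ∂μ) atTop (𝓝 (∫ f, ℓ f ∂μ)) := by
      refine tendsto_integral_of_dominated_convergence (fun f => C * ‖f‖) (fun n => ?_)
        ((h2.integrable one_le_two).norm.const_mul C) (fun n => ?_) ?_
      · exact Continuous.aestronglyMeasurable (by fun_prop)
      · exact Eventually.of_forall fun f => hb n f
      · exact Eventually.of_forall hσ
    have t3 : Tendsto (fun n => ∫ f, L (σ n) f ^ 2 ∂μ) atTop (𝓝 (∫ f, ℓ f ^ 2 ∂μ)) := by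
      refine tendsto_integral_of_dominated_convergence (fun f => C ^ 2 * ‖f‖ ^ 2) (fun n => ?_)
        ((h2.integrable_norm_pow (by simp)).const_mul (C ^ 2)) (fun n => ?_) ?_
      · exact Continuous.aestronglyMeasurable (by fun_prop)
      · refine Eventually.of_forall fun f => ?_
        rw [norm_pow, ← mul_pow]
        exact pow_le_pow_left₀ (norm_nonneg _) (hb n f) 2
      · exact Eventually.of_forall fun f => (hσ f).pow 2
    refine tendsto_nhds_unique t1 ?_
    have t4 := (continuous_gaussianChar.tendsto (∫ f, ℓ f ∂μ, ∫ f, ℓ f ^ 2 ∂μ)).comp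
      (t2.prodMk_nhds t3)
    exact t4.congr fun n => (h (σ n)).symm

lemma measurableSet_isGaussian [CompleteSpace E] [SecondCountableTopology E] {β : Type*}
    [MeasurableSpace β] (κ : Kernel β E) [IsMarkovKernel κ] :
    MeasurableSet {b | IsGaussian (κ b)} := by
  obtain ⟨L, hL⟩ := exists_countable_dense_strongDual E
  have h : {b | IsGaussian (κ b)} = {b | ∫⁻ f, ‖f‖ₑ ^ (2 : ℝ) ∂(κ b) < ∞} ∩
      ⋂ i, {b | ∫ f, Complex.exp (L i f * Complex.I) ∂(κ b)
        = gaussianChar (∫ f, L i f ∂(κ b)) (∫ f, L i f ^ 2 ∂(κ b))} := by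
    ext b
    simp only [Set.mem_ofPred_eq, Set.mem_inter_iff, Set.mem_iInter]
    rw [isGaussian_iff_of_dense hL]
    refine and_congr_left' ⟨fun h => ?_, fun h => ⟨aestronglyMeasurable_id, ?_⟩⟩
    · simpa using lintegral_rpow_enorm_lt_top_of_eLpNorm_lt_top (by simp) (by simp) h.2
    · rw [eLpNorm_lt_top_iff_lintegral_rpow_enorm_lt_top (by simp) (by simp)]
      simpa using h
  rw [h]
  refine (measurableSet_lt (Measurable.lintegral_kernel (by fun_prop)) measurable_const).inter
    (MeasurableSet.iInter fun i => measurableSet_eq_fun ?_ ?_)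
  · refine (StronglyMeasurable.integral_kernel ?_).measurable
    exact Continuous.stronglyMeasurable (by fun_prop)
  · refine continuous_gaussianChar.measurable.comp (Measurable.prodMk ?_ ?_)
    · refine (StronglyMeasurable.integral_kernel ?_).measurable
      exact Continuous.stronglyMeasurable (by fun_prop)
    · refine (StronglyMeasurable.integral_kernel ?_).measurable
      exact Continuous.stronglyMeasurable (by fun_prop)

end Gaussian

/-! ### Convergence of the conditional distributions along a filtration -/

section Convergence

variable {Ω : Type*} {mΩ : MeasurableSpace Ω} {P : Measure Ω} [IsProbabilityMeasure P]
  {ξ : Ω → C(X, ℝ)} {ℱ : Filtration ℕ mΩ} {ν : ℕ → Ω → GM X} {ν' : Ω → GM X}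

lemma memLp_of_isGaussian_map (hξ : Measurable ξ) (hG : IsGaussian (P.map ξ)) : MemLp ξ 2 P := by
  have h : MemLp id 2 (P.map ξ) := IsGaussian.memLp_two_id
  exact (memLp_map_measure_iff aestronglyMeasurable_id hξ.aemeasurable).1 h

lemma IsCondLaw.ae_tendsto_integral {F : Type*} [NormedAddCommGroup F] [NormedSpace ℝ F]
    [CompleteSpace F] [TopologicalSpace.SeparableSpace F] (hξ : Measurable ξ)
    (hν : ∀ n, IsCondLaw (ℱ n) P ξ (ν n)) {g : C(X, ℝ) → F} (hg : StronglyMeasurable g)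
    (hint : Integrable (fun ω => g (ξ ω)) P) :
    ∀ᵐ ω ∂P, Tendsto (fun n => ∫ f, g f ∂(ν n ω).meas) atTop
      (𝓝 ((P[fun ω => g (ξ ω) | ⨆ n, ℱ n]) ω)) := by
  filter_upwards [tendsto_ae_condExp_of_separable (P := P) ℱ (fun ω => g (ξ ω)),
    ae_all_iff.2 fun n => (hν n).condExp_ae_eq hξ hg hint] with ω h1 h2
  exact h1.congr h2

/-- Means and second moments are the closed martingales E[ξ | ℱ_n] and E[ξ ⊗ ξ | ℱ_n] in C(X) and
C(X × X); the covariance is a continuous function of the two. -/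
theorem IsCondLaw.ae_tendstoGM (hξ : Measurable ξ) (hG : IsGaussian (P.map ξ))
    (hν : ∀ n, IsCondLaw (ℱ n) P ξ (ν n)) (hν' : IsCondLaw (⨆ n, ℱ n) P ξ ν') :
    ∀ᵐ ω ∂P, GM.TendstoGM (fun n => ν n ω) (ν' ω) := by
  have h2 := memLp_of_isGaussian_map hξ hG
  have i1 : Integrable (fun ω => ξ ω) P := h2.integrable one_le_two
  have i2 := integrable_tensorSq h2
  have sm1 : StronglyMeasurable fun f : C(X, ℝ) => f := stronglyMeasurable_id
  have sm2 : StronglyMeasurable (tensorSq : C(X, ℝ) → C(X × X, ℝ)) :=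
    continuous_tensorSq.stronglyMeasurable
  filter_upwards [IsCondLaw.ae_tendsto_integral hξ hν sm1 i1,
    IsCondLaw.ae_tendsto_integral hξ hν sm2 i2, hν'.condExp_ae_eq hξ sm1 i1,
    hν'.condExp_ae_eq hξ sm2 i2] with ω t1 t2 e1 e2
  rw [e1] at t1
  rw [e2] at t2
  exact tendstoGM_iff.2 ⟨t1, t2.sub ((continuous_tensorSq.tendsto _).comp t1)⟩

lemma ae_memLp_condDistrib {β : Type*} [MeasurableSpace β] {Y : Ω → β} (hY : Measurable Y)
    (hξ : Measurable ξ) (h : MemLp ξ 2 P) :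
    ∀ᵐ ω ∂P, MemLp id 2 (condDistrib ξ Y P (Y ω)) := by
  have hint : Integrable (fun p : β × C(X, ℝ) => ‖p.2‖ ^ 2) (P.map fun ω => (Y ω, ξ ω)) :=
    (integrable_map_measure (by fun_prop) (by fun_prop)).2 (h.integrable_norm_pow (by simp))
  filter_upwards [hint.condDistrib_ae hY.aemeasurable hξ.aemeasurable] with ω hω
  exact (memLp_two_iff_integrable_sq_norm aestronglyMeasurable_id).2 hω

/-- For each functional of the countable family, the characteristic function at 1 and the first two
moments under `ν n` converge to those under the conditional law given ⨆ ℱ_n, so the Gaussian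
relation between them is inherited. -/
lemma ae_isGaussian_condDistrib (hξ : Measurable ξ) (hG : IsGaussian (P.map ξ))
    (hν : ∀ n, IsCondLaw (ℱ n) P ξ (ν n)) :
    ∀ᵐ ω ∂P, IsGaussian (@condDistrib Ω Ω C(X, ℝ) _ _ _ mΩ (⨆ n, ℱ n) ξ id P _ ω) := by
  have hle : ⨆ n, ℱ n ≤ mΩ := iSup_le ℱ.le
  have h2 := memLp_of_isGaussian_map hξ hG
  have i1 : Integrable (fun ω => ξ ω) P := h2.integrable one_le_two
  obtain ⟨L, hL⟩ := exists_countable_dense_strongDual C(X, ℝ)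
  have key : ∀ i, ∀ᵐ ω ∂P,
      ∫ f, Complex.exp (L i f * Complex.I)
        ∂(@condDistrib Ω Ω C(X, ℝ) _ _ _ mΩ (⨆ n, ℱ n) ξ id P _ ω)
      = gaussianChar (∫ f, L i f ∂(@condDistrib Ω Ω C(X, ℝ) _ _ _ mΩ (⨆ n, ℱ n) ξ id P _ ω))
        (∫ f, L i f ^ 2 ∂(@condDistrib Ω Ω C(X, ℝ) _ _ _ mΩ (⨆ n, ℱ n) ξ id P _ ω)) := by
    intro i
    have hLc : Continuous fun f => Complex.exp (L i f * Complex.I) := by fun_prop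
    have sm1 : StronglyMeasurable fun f => Complex.exp (L i f * Complex.I) :=
      hLc.stronglyMeasurable
    have sm2 : StronglyMeasurable fun f => L i f := (L i).continuous.stronglyMeasurable
    have sm3 : StronglyMeasurable fun f => L i f ^ 2 := ((L i).continuous.pow 2).stronglyMeasurable
    have j1 : Integrable (fun ω => Complex.exp (L i (ξ ω) * Complex.I)) P :=
      Integrable.of_bound (hLc.measurable.comp hξ).aestronglyMeasurable 1
        (Eventually.of_forall fun ω => by rw [Complex.norm_exp_ofReal_mul_I])
    have j2 : Integrable (fun ω => L i (ξ ω)) P := (L i).integrable_comp i1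
    have j3 : Integrable (fun ω => L i (ξ ω) ^ 2) P := ((L i).comp_memLp' h2).integrable_sq
    filter_upwards [IsCondLaw.ae_tendsto_integral hξ hν sm1 j1,
      IsCondLaw.ae_tendsto_integral hξ hν sm2 j2, IsCondLaw.ae_tendsto_integral hξ hν sm3 j3,
      condExp_ae_eq_integral_condDistrib_of_le hle hξ sm1 j1,
      condExp_ae_eq_integral_condDistrib_of_le hle hξ sm2 j2,
      condExp_ae_eq_integral_condDistrib_of_le hle hξ sm3 j3] with ω t1 t2 t3 e1 e2 e3
    rw [e1] at t1
    rw [e2] at t2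
    rw [e3] at t3
    refine tendsto_nhds_unique t1 ?_
    have t4 := (continuous_gaussianChar.tendsto (_, _)).comp (t2.prodMk_nhds t3)
    refine t4.congr fun n => ?_
    have h3 := (gaussian_identity_iff (ν n ω).meas (ν n ω).memLp_id (L i)).1 (by
      rw [IsGaussian.charFunDual_eq, integral_complex_ofReal])
    exact h3.symm
  have hsq : ∀ᵐ ω ∂P, MemLp id 2 (@condDistrib Ω Ω C(X, ℝ) _ _ _ mΩ (⨆ n, ℱ n) ξ id P _ ω) :=
    @ae_memLp_condDistrib X _ _ Ω mΩ P _ ξ Ω (⨆ n, ℱ n) id (measurable_id'' hle) hξ h2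
  filter_upwards [ae_all_iff.2 key, hsq] with ω h3 h4
  exact (isGaussian_iff_of_dense hL _).2 ⟨h4, h3⟩

lemma exists_isCondLaw_of_ae_isGaussian {m : MeasurableSpace Ω} (hm : m ≤ mΩ)
    (hξ : Measurable[mΩ] ξ)
    (h : ∀ᵐ ω ∂P, IsGaussian (@condDistrib Ω Ω C(X, ℝ) _ _ _ mΩ m ξ id P _ ω)) :
    ∃ ν' : Ω → GM X, IsCondLaw m P ξ ν' := by
  classical
  set κ := @condDistrib Ω Ω C(X, ℝ) _ _ _ mΩ m ξ id P _ with hκ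
  -- The Dirac mass at 0 is only a Gaussian filler on the null, measurable set where the conditional
  -- law fails to be Gaussian.
  let ν' : Ω → GM X := fun ω =>
    if h : IsGaussian (κ ω) then ⟨κ ω, h⟩ else ⟨Measure.dirac 0, inferInstance⟩
  have hν' : ∀ ω, (ν' ω).meas = if IsGaussian (κ ω) then κ ω else Measure.dirac 0 := by
    intro ω
    simp only [ν']
    split_ifs <;> rfl
  refine ⟨ν', hm, ?_, fun A hA => ?_⟩
  · refine (@measurable_gm_iff X _ _ Ω m ν').2 fun A hA => ?_
    have h1 : (fun ω => (ν' ω).meas A)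
        = fun ω => if IsGaussian (κ ω) then κ ω A else Measure.dirac 0 A := by
      ext ω
      rw [hν']
      split_ifs <;> rfl
    rw [h1]
    exact Measurable.ite (@measurableSet_isGaussian C(X, ℝ) _ _ _ _ _ _ Ω m κ _)
      (@Kernel.measurable_coe Ω C(X, ℝ) m _ κ A hA) (@measurable_const _ _ _ m _)
  · have h2 := @condDistrib_ae_eq_condExp Ω Ω C(X, ℝ) _ _ _ mΩ P _ id ξ m A
      (measurable_id'' hm) hξ hA
    rw [MeasurableSpace.comap_id] at h2
    refine EventuallyEq.trans ?_ h2
    filter_upwards [h] with ω hω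
    rw [hν', if_pos hω]
    rfl

theorem exists_isCondLaw_iSup (hξ : Measurable ξ) (hG : IsGaussian (P.map ξ))
    (hν : ∀ n, IsCondLaw (ℱ n) P ξ (ν n)) : ∃ ν' : Ω → GM X, IsCondLaw (⨆ n, ℱ n) P ξ ν' :=
  exists_isCondLaw_of_ae_isGaussian (iSup_le ℱ.le) hξ (ae_isGaussian_condDistrib hξ hG hν)

end Convergence

/-! ### Conditioning a Gaussian measure on one noisy observation -/

/-- Continuous functionals commute with the Bochner integral E[f(x) f] - m(x) m. Covariances with
f(x) are needed for the whole dual, not just for evaluations, because independence in C(X) is tested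
on all functionals. -/
lemma GM.exists_covariance_dual_eq (ν : GM X) (x : X) : ∃ k : C(X, ℝ),
    ∀ L : StrongDual ℝ C(X, ℝ), cov[L, fun f : C(X, ℝ) => f x; ν.meas] = L k := by
  refine ⟨∫ f : C(X, ℝ), f x • f ∂ν.meas - ν.mean x • ν.meanC, fun L => ?_⟩
  have hint : Integrable (fun f : C(X, ℝ) => f x • f) ν.meas :=
    memLp_one_iff_integrable.1 (ν.memLp_id.smul (ν.memLp_eval x))
  have h1 : MemLp (fun f : C(X, ℝ) => L f) 2 ν.meas := L.comp_memLp' ν.memLp_id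
  rw [covariance_eq_sub h1 (ν.memLp_eval x), map_sub, map_smul, ← L.integral_comp_comm hint,
    GM.meanC, ← L.integral_comp_comm (ν.memLp_id.integrable one_le_two)]
  simp [GM.mean, mul_comm]

lemma GM.cov_self_nonneg (ν : GM X) (x : X) : 0 ≤ ν.cov x x := by
  rw [GM.cov, covariance_self (ν.memLp_eval x).aemeasurable]
  exact variance_nonneg _ _

/-- Zero predictive variance forces f(x) to be almost surely constant. This makes division by zero
in `gainFun` harmless: `predVar_mul_gainFun` holds without exception. -/
lemma GM.cov_eq_zero_of_predVar_eq_zero {τ : C(X, ℝ≥0)} {ν : GM X} {x : X}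
    (h : predVar τ ν x = 0) (y : X) : ν.cov y x = 0 := by
  have h1 : ν.cov x x = 0 := by
    have := ν.cov_self_nonneg x
    have := sq_nonneg (τ x : ℝ)
    unfold predVar at h
    linarith
  have hint : MemLp (fun f : C(X, ℝ) => f x - ν.mean x) 2 ν.meas :=
    (ν.memLp_eval x).sub (memLp_const _)
  have h2 : (fun f : C(X, ℝ) => (f x - ν.mean x) * (f x - ν.mean x)) =ᵐ[ν.meas] 0 := by
    rw [← integral_eq_zero_iff_of_nonneg (fun f => mul_self_nonneg _)]
    · exact h1
    · simpa only [sq] using hint.integrable_sq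
  unfold GM.cov covariance
  refine integral_eq_zero_of_ae ?_
  filter_upwards [h2] with f hf
  have hf' : f x - ∫ f : C(X, ℝ), f x ∂ν.meas = 0 := mul_self_eq_zero.1 hf
  simp [hf']

lemma predVar_mul_gainFun (τ : C(X, ℝ≥0)) (ν : GM X) (x y : X) :
    predVar τ ν x * gainFun τ ν x y = ν.cov y x := by
  by_cases h : predVar τ ν x = 0
  · rw [h, zero_mul, GM.cov_eq_zero_of_predVar_eq_zero h]
  · exact mul_div_cancel₀ _ h

lemma condPt_eq_self {τ : C(X, ℝ≥0)} {ν : GM X} {x : X} (h : predVar τ ν x = 0) (z : ℝ) :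
    condPt τ x z ν = ν := by
  have h0 : gainFun τ ν x = 0 := by
    ext y
    simp [gainFun, h]
  have h1 : condMap τ x z ν = Prod.fst := by
    ext p
    simp [condMap, h0]
  refine Subtype.ext ?_
  change (ν.meas.prod (gaussianReal 0 1)).map (condMap τ x z ν) = ν.meas
  rw [h1, Measure.map_fst_prod]
  simp

/-- The noisy observation at `x`, as a function of the process and of the noise variable. -/
def obsMap (τ : C(X, ℝ≥0)) (x : X) (p : C(X, ℝ) × ℝ) : ℝ := p.1 x + p.2 * τ x

/-- The noisy observation at `x`, as a continuous linear form. -/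
def obsCLM (τ : C(X, ℝ≥0)) (x : X) : C(X, ℝ) × ℝ →L[ℝ] ℝ :=
  (ContinuousMap.evalCLM ℝ x).comp (ContinuousLinearMap.fst ℝ C(X, ℝ) ℝ) +
    (τ x : ℝ) • ContinuousLinearMap.snd ℝ C(X, ℝ) ℝ

lemma coe_obsCLM (τ : C(X, ℝ≥0)) (x : X) : ⇑(obsCLM τ x) = obsMap τ x := by
  ext p
  simp [obsCLM, obsMap, mul_comm]

/-- The residual `f - Z(x) k_ν(·, x) / s_ν²(x)`, as a continuous linear map. -/
def residCLM (τ : C(X, ℝ≥0)) (x : X) (ν : GM X) : C(X, ℝ) × ℝ →L[ℝ] C(X, ℝ) :=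
  ContinuousLinearMap.fst ℝ C(X, ℝ) ℝ - (obsCLM τ x).smulRight (gainFun τ ν x)

lemma condMap_eq (τ : C(X, ℝ≥0)) (x : X) (z : ℝ) (ν : GM X) (p : C(X, ℝ) × ℝ) :
    condMap τ x z ν p = residCLM τ x ν p + z • gainFun τ ν x := by
  ext y
  simp [condMap, residCLM, coe_obsCLM, obsMap]
  ring

lemma residCLM_add_smul (τ : C(X, ℝ≥0)) (x : X) (ν : GM X) (p : C(X, ℝ) × ℝ) :
    residCLM τ x ν p + obsMap τ x p • gainFun τ ν x = p.1 := by
  simp [residCLM, coe_obsCLM]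

lemma covariance_dual_obs (τ : C(X, ℝ≥0)) (x : X) (ν : GM X) (L : StrongDual ℝ C(X, ℝ)) :
    cov[fun p : C(X, ℝ) × ℝ => L p.1, obsMap τ x; ν.meas.prod (gaussianReal 0 1)]
      = predVar τ ν x * L (gainFun τ ν x) := by
  obtain ⟨k, hk⟩ := ν.exists_covariance_dual_eq x
  have hk' : k = predVar τ ν x • gainFun τ ν x := by
    ext y
    rw [ContinuousMap.smul_apply, smul_eq_mul, predVar_mul_gainFun]
    exact (hk (ContinuousMap.evalCLM ℝ y)).symm
  have hL : MemLp (fun f : C(X, ℝ) => L f) 2 ν.meas := L.comp_memLp' ν.memLp_id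
  have hL' : MemLp (fun p : C(X, ℝ) × ℝ => L p.1) 2 (ν.meas.prod (gaussianReal 0 1)) :=
    hL.comp_fst _
  have h1 : cov[fun p : C(X, ℝ) × ℝ => L p.1, fun p => p.2 * τ x;
      ν.meas.prod (gaussianReal 0 1)] = 0 := by
    rw [covariance_mul_const_right, covariance_fst_snd_prod (Y := fun u : ℝ => u) hL
      (memLp_id_gaussianReal' (μ := 0) (v := 1) 2 (by simp)), zero_mul]
  have h2 : cov[fun p : C(X, ℝ) × ℝ => L p.1, fun p => p.1 x;
      ν.meas.prod (gaussianReal 0 1)] = L k := by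
    rw [← hk L]
    have hf : (ν.meas.prod (gaussianReal 0 1)).map Prod.fst = ν.meas := by
      rw [Measure.map_fst_prod]; simp
    have h := covariance_map_fun (μ := ν.meas.prod (gaussianReal 0 1)) (Z := Prod.fst)
      (X := fun f : C(X, ℝ) => L f) (Y := fun f : C(X, ℝ) => f x)
      L.continuous.aestronglyMeasurable (aestronglyMeasurable_eval _ x)
      measurable_fst.aemeasurable
    rw [hf] at h
    exact h.symm
  have h3 := covariance_add_right hL' (memLp_eval_fst ν x) ((memLp_snd ν).mul_const (τ x : ℝ))
  refine h3.trans ?_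
  rw [h1, h2, hk', map_smul, add_zero, smul_eq_mul]

lemma variance_obs (τ : C(X, ℝ≥0)) (x : X) (ν : GM X) :
    cov[obsMap τ x, obsMap τ x; ν.meas.prod (gaussianReal 0 1)] = predVar τ ν x := by
  set Q := ν.meas.prod (gaussianReal 0 1)
  have hA := memLp_eval_fst ν x
  have hB : MemLp (fun p : C(X, ℝ) × ℝ => p.2 * τ x) 2 Q := (memLp_snd ν).mul_const _
  have hO : MemLp (obsMap τ x) 2 Q := hA.add hB
  have h1 : cov[fun p : C(X, ℝ) × ℝ => p.1 x, obsMap τ x; Q] = ν.cov x x := by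
    rw [← predVar_mul_gainFun τ]
    exact covariance_dual_obs τ x ν (ContinuousMap.evalCLM ℝ x)
  have h2 : cov[fun p : C(X, ℝ) × ℝ => p.2, fun p => p.1 x; Q] = 0 := by
    rw [covariance_comm]
    exact covariance_fst_snd_prod (ν.memLp_eval x)
      (memLp_id_gaussianReal' (μ := 0) (v := 1) 2 (by simp))
  have h3 : cov[fun p : C(X, ℝ) × ℝ => p.2, fun p => p.2; Q] = 1 := by
    have hs : Q.map Prod.snd = gaussianReal 0 1 := by simp [Q, Measure.map_snd_prod]
    have h := covariance_map_fun (μ := Q) (Z := Prod.snd) (X := fun u : ℝ => u)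
      (Y := fun u : ℝ => u) (by fun_prop) (by fun_prop) measurable_snd.aemeasurable
    rw [hs] at h
    rw [← h, covariance_self (by fun_prop)]
    exact variance_id_gaussianReal.trans (by simp)
  have h4 : cov[fun p : C(X, ℝ) × ℝ => p.2 * τ x, obsMap τ x; Q] = τ x ^ 2 := by
    refine (covariance_add_right hB hA hB).trans ?_
    rw [covariance_mul_const_left, covariance_mul_const_left, covariance_mul_const_right, h2, h3]
    ring
  refine (covariance_add_left hA hB hO).trans ?_
  rw [h1, h4]
  rfl

/-- Residual and observation are jointly Gaussian, being linear images of (f, u). With g the gain,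
the covariance of L(f) - Z L(g) with Z is s² L(g) - s² L(g) = 0, also when s² = 0. -/
lemma indepFun_resid_obs (τ : C(X, ℝ≥0)) (x : X) (ν : GM X) :
    IndepFun (obsMap τ x) (residCLM τ x ν) (ν.meas.prod (gaussianReal 0 1)) := by
  set Q := ν.meas.prod (gaussianReal 0 1)
  have hg : HasGaussianLaw (fun p => (residCLM τ x ν p, obsMap τ x p)) Q := by
    refine ⟨?_⟩
    rw [← coe_obsCLM]
    exact isGaussian_map ((residCLM τ x ν).prod (obsCLM τ x))
  refine (hg.indepFun_of_covariance_strongDual fun L c => ?_).symm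
  have hO : MemLp (obsMap τ x) 2 Q := by
    rw [← coe_obsCLM]
    exact IsGaussian.memLp_dual Q (obsCLM τ x) 2 (by simp)
  have hL : MemLp (fun p : C(X, ℝ) × ℝ => L p.1) 2 Q :=
    MemLp.comp_fst (f := fun f : C(X, ℝ) => L f) (L.comp_memLp' ν.memLp_id) _
  have h1 : (L ∘ residCLM τ x ν) = fun p => L p.1 - obsMap τ x p * L (gainFun τ ν x) := by
    ext p
    simp [residCLM, coe_obsCLM]
  have h2 : (c ∘ obsMap τ x) = fun p => obsMap τ x p * c 1 := by
    ext p
    have := c.map_smul (obsMap τ x p) 1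
    simpa using this
  rw [h1, h2, covariance_mul_const_right, covariance_fun_sub_left hL (hO.mul_const _) hO,
    covariance_mul_const_left, covariance_dual_obs, variance_obs]
  ring

/-- Bayes' formula for one observation. Since f = R + Z g with R independent of Z, replacing R by an
independent copy leaves the law of (Z, f) unchanged, and R + z g has law `condPt τ x z ν`. -/
theorem lintegral_condPt (τ : C(X, ℝ≥0)) (x : X) (ν : GM X) {G : ℝ × C(X, ℝ) → ℝ≥0∞}
    (hG : Measurable G) :
    ∫⁻ f, ∫⁻ u, ∫⁻ f', G (f x + u * τ x, f') ∂(condPt τ x (f x + u * τ x) ν).meas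
        ∂(gaussianReal 0 1) ∂ν.meas
      = ∫⁻ f, ∫⁻ u, G (f x + u * τ x, f) ∂(gaussianReal 0 1) ∂ν.meas := by
  set Q := ν.meas.prod (gaussianReal 0 1)
  have hOm : Measurable (obsMap τ x) := by
    rw [← coe_obsCLM]; exact (obsCLM τ x).continuous.measurable
  have hRm : Measurable (residCLM τ x ν) := (residCLM τ x ν).continuous.measurable
  have hshift : Measurable fun q : ℝ × C(X, ℝ) => G (q.1, q.2 + q.1 • gainFun τ ν x) := by
    refine hG.comp (Measurable.prodMk measurable_fst ?_)
    exact Continuous.measurable (by fun_prop)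
  have h1 : ∀ z, ∫⁻ f', G (z, f') ∂(condPt τ x z ν).meas
      = ∫⁻ p, G (z, residCLM τ x ν p + z • gainFun τ ν x) ∂Q := by
    intro z
    change ∫⁻ f', G (z, f') ∂(Q.map (condMap τ x z ν)) = _
    have h := lintegral_map (μ := Q) (f := fun f' => G (z, f')) (hG.comp measurable_prodMk_left)
      (continuous_condMap τ x z ν).measurable
    simpa only [condMap_eq] using h
  have h2 : Measurable fun z => ∫⁻ p, G (z, residCLM τ x ν p + z • gainFun τ ν x) ∂Q := by
    refine Measurable.lintegral_prod_right' (f := fun q : ℝ × (C(X, ℝ) × ℝ) =>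
      G (q.1, residCLM τ x ν q.2 + q.1 • gainFun τ ν x)) ?_
    exact hshift.comp (measurable_fst.prodMk (hRm.comp measurable_snd))
  have hL := lintegral_prod (μ := ν.meas) (ν := gaussianReal 0 1)
    (fun p => ∫⁻ p', G (obsMap τ x p, residCLM τ x ν p' + obsMap τ x p • gainFun τ ν x) ∂Q)
    (h2.comp hOm).aemeasurable
  have hR := lintegral_prod (μ := ν.meas) (ν := gaussianReal 0 1)
    (fun p => G (obsMap τ x p, p.1)) (hG.comp (hOm.prodMk measurable_fst)).aemeasurable
  simp_rw [h1]
  refine hL.symm.trans (Eq.trans ?_ hR)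
  have h3 := (indepFun_iff_map_prod_eq_prod_map_map hOm.aemeasurable hRm.aemeasurable).1
    (indepFun_resid_obs τ x ν)
  have h4 := lintegral_map (μ := Q) hshift (hOm.prodMk hRm)
  rw [h3, lintegral_prod _ hshift.aemeasurable, lintegral_map (by fun_prop) hOm] at h4
  simp_rw [residCLM_add_smul] at h4
  rw [← h4]
  refine lintegral_congr fun p => ?_
  exact (lintegral_map (f := fun y => G (obsMap τ x p, y + obsMap τ x p • gainFun τ ν x))
    (hshift.comp measurable_prodMk_left) hRm).symm

section

variable [MeasurableSpace X] [BorelSpace X]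

/-! ### Conditioning a conditional distribution on one more noisy observation -/

section Step

variable {Ω β : Type*} {mβ : MeasurableSpace β} {mΩ : MeasurableSpace Ω} {P : Measure Ω}
  [IsProbabilityMeasure P] {ξ : Ω → C(X, ℝ)} {Y : Ω → β} {η : β → GM X} {U : Ω → ℝ}

lemma lintegral_disintegration_noise (hξ : Measurable ξ) (hY : Measurable Y) (hη : Measurable η)
    (h : ∀ S, MeasurableSet S → ∀ A, MeasurableSet A →
      ∫⁻ ω in Y ⁻¹' S, (η (Y ω)).meas A ∂P = P (Y ⁻¹' S ∩ ξ ⁻¹' A))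
    (hU : Measurable U) (hlaw : P.map U = gaussianReal 0 1)
    (hind : IndepFun (fun ω => (Y ω, ξ ω)) U P)
    {G : (β × C(X, ℝ)) × ℝ → ℝ≥0∞} (hG : Measurable G) :
    ∫⁻ ω, G ((Y ω, ξ ω), U ω) ∂P =
      ∫⁻ ω, ∫⁻ f, ∫⁻ u, G ((Y ω, f), u) ∂(gaussianReal 0 1) ∂(η (Y ω)).meas ∂P := by
  have hYξ : Measurable fun ω => (Y ω, ξ ω) := hY.prodMk hξ
  have hGm : Measurable fun q : β × C(X, ℝ) => ∫⁻ u, G (q, u) ∂(gaussianReal 0 1) :=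
    hG.lintegral_prod_right'
  rw [← lintegral_disintegration hξ hY hη h hGm, ← lintegral_map hG (hYξ.prodMk hU),
    (indepFun_iff_map_prod_eq_prod_map_map hYξ.aemeasurable hU.aemeasurable).1 hind, hlaw,
    lintegral_prod _ hG.aemeasurable, lintegral_map hGm hYξ]

lemma measurable_obs_prod (τ : C(X, ℝ≥0)) {x : β → X} (hx : Measurable x) :
    Measurable fun q : (β × C(X, ℝ)) × ℝ => q.1.2 (x q.1.1) + q.2 * τ (x q.1.1) := by
  have h1 : Measurable fun q : (β × C(X, ℝ)) × ℝ => q.1.2 (x q.1.1) :=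
    measurable_continuousMap_eval.comp
      (f := fun q : (β × C(X, ℝ)) × ℝ => (q.1.2, x q.1.1)) (by fun_prop)
  exact h1.add (measurable_snd.mul ((measurable_noise τ).comp (by fun_prop)))

lemma measurable_condPt_prod (τ : C(X, ℝ≥0)) {x : β → X} (hx : Measurable x) (hη : Measurable η) :
    Measurable fun q : (β × C(X, ℝ)) × ℝ =>
      condPt τ (x q.1.1) (q.1.2 (x q.1.1) + q.2 * τ (x q.1.1)) (η q.1.1) :=
  (measurable_condPt τ).comp
    (f := fun q : (β × C(X, ℝ)) × ℝ =>
      (x q.1.1, q.1.2 (x q.1.1) + q.2 * τ (x q.1.1), η q.1.1))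
    (Measurable.prodMk (by fun_prop) ((measurable_obs_prod τ hx).prodMk (by fun_prop)))

/-- Given Y = b, the design point x(b) is fixed, so `lintegral_condPt` applies with test function
1_T(b, z) 1_A(f) (this is `e3`); disintegrating over Y gives the claim. -/
lemma setLIntegral_condPt_prod (τ : C(X, ℝ≥0)) (hξ : Measurable ξ) (hY : Measurable Y)
    (hη : Measurable η)
    (h : ∀ S, MeasurableSet S → ∀ A, MeasurableSet A →
      ∫⁻ ω in Y ⁻¹' S, (η (Y ω)).meas A ∂P = P (Y ⁻¹' S ∩ ξ ⁻¹' A))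
    (hU : Measurable U) (hlaw : P.map U = gaussianReal 0 1)
    (hind : IndepFun (fun ω => (Y ω, ξ ω)) U P) {x : β → X} (hx : Measurable x)
    {T : Set (β × ℝ)} (hT : MeasurableSet T) {A : Set C(X, ℝ)} (hA : MeasurableSet A) :
    ∫⁻ ω in (fun ω => (Y ω, ξ ω (x (Y ω)) + U ω * τ (x (Y ω)))) ⁻¹' T,
        (condPt τ (x (Y ω)) (ξ ω (x (Y ω)) + U ω * τ (x (Y ω))) (η (Y ω))).meas A ∂P
      = P ((fun ω => (Y ω, ξ ω (x (Y ω)) + U ω * τ (x (Y ω)))) ⁻¹' T ∩ ξ ⁻¹' A) := by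
  have hZ := measurable_obs_prod τ hx
  have hYZ : Measurable fun q : (β × C(X, ℝ)) × ℝ =>
      (q.1.1, q.1.2 (x q.1.1) + q.2 * τ (x q.1.1)) := Measurable.prodMk (by fun_prop) hZ
  have hC := measurable_condPt_prod τ hx hη
  have hV : Measurable fun ω => ((Y ω, ξ ω), U ω) := (hY.prodMk hξ).prodMk hU
  have hS : MeasurableSet ((fun ω => (Y ω, ξ ω (x (Y ω)) + U ω * τ (x (Y ω)))) ⁻¹' T) :=
    (hYZ.comp hV) hT
  set I : (β × C(X, ℝ)) × ℝ → ℝ≥0∞ := fun q =>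
    T.indicator 1 (q.1.1, q.1.2 (x q.1.1) + q.2 * τ (x q.1.1)) with hI
  have hIm : Measurable I := (measurable_one.indicator hT).comp hYZ
  have e1 := lintegral_disintegration_noise hξ hY hη h hU hlaw hind
    (G := fun q => I q *
      (condPt τ (x q.1.1) (q.1.2 (x q.1.1) + q.2 * τ (x q.1.1)) (η q.1.1)).meas A)
    (hIm.mul (measurable_meas_apply hC hA))
  have e2 := lintegral_disintegration_noise hξ hY hη h hU hlaw hind
    (G := fun q => I q * A.indicator 1 q.1.2)
    (hIm.mul ((measurable_one.indicator hA).comp (by fun_prop)))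
  have e3 : ∀ b : β, ∫⁻ f, ∫⁻ u, I ((b, f), u) *
      (condPt τ (x b) (f (x b) + u * τ (x b)) (η b)).meas A ∂(gaussianReal 0 1) ∂(η b).meas
      = ∫⁻ f, ∫⁻ u, I ((b, f), u) * A.indicator 1 f ∂(gaussianReal 0 1) ∂(η b).meas := by
    intro b
    have hTm : Measurable fun z : ℝ => T.indicator (1 : β × ℝ → ℝ≥0∞) (b, z) :=
      (measurable_one.indicator hT).comp measurable_prodMk_left
    rw [← lintegral_condPt τ (x b) (η b)
      (G := fun q => T.indicator 1 (b, q.1) * A.indicator 1 q.2)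
      ((hTm.comp measurable_fst).mul ((measurable_one.indicator hA).comp measurable_snd))]
    refine lintegral_congr fun f => lintegral_congr fun u => ?_
    dsimp only
    rw [lintegral_const_mul _ (measurable_one.indicator hA), lintegral_indicator_one hA]
  classical
  rw [← lintegral_indicator hS, ← lintegral_indicator_one (hS.inter (hξ hA))]
  calc _ = _ := lintegral_congr fun ω => ?_
    _ = _ := e1.trans ((lintegral_congr fun ω => e3 (Y ω)).trans e2.symm)
    _ = _ := lintegral_congr fun ω => ?_
  · simp only [hI, Set.indicator_apply, Set.mem_preimage, Pi.one_apply]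
    split_ifs <;> simp
  · simp only [hI, Set.indicator_apply, Set.mem_preimage, Set.mem_inter_iff, Pi.one_apply]
    split_ifs <;> simp_all

/-- After disintegration over Y, the inner double integral is `crit` by definition: the criterion is
the conditional expectation of H after the next observation. -/
lemma setLIntegral_crit_prod (τ : C(X, ℝ≥0)) (hξ : Measurable ξ) (hY : Measurable Y)
    (hη : Measurable η)
    (h : ∀ S, MeasurableSet S → ∀ A, MeasurableSet A →
      ∫⁻ ω in Y ⁻¹' S, (η (Y ω)).meas A ∂P = P (Y ⁻¹' S ∩ ξ ⁻¹' A))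
    (hU : Measurable U) (hlaw : P.map U = gaussianReal 0 1)
    (hind : IndepFun (fun ω => (Y ω, ξ ω)) U P) {x : β → X} (hx : Measurable x)
    {H : GM X → ℝ≥0} (hH : Measurable H) {S : Set β} (hS : MeasurableSet S) :
    ∫⁻ ω in Y ⁻¹' S, H (condPt τ (x (Y ω)) (ξ ω (x (Y ω)) + U ω * τ (x (Y ω))) (η (Y ω))) ∂P
      = ∫⁻ ω in Y ⁻¹' S, crit τ H (x (Y ω)) (η (Y ω)) ∂P := by
  classical
  have e := lintegral_disintegration_noise hξ hY hη h hU hlaw hind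
    (G := fun q => S.indicator (1 : β → ℝ≥0∞) q.1.1 *
      H (condPt τ (x q.1.1) (q.1.2 (x q.1.1) + q.2 * τ (x q.1.1)) (η q.1.1)))
    (((measurable_one.indicator hS).comp (by fun_prop)).mul
      (hH.comp (measurable_condPt_prod τ hx hη)).coe_nnreal_ennreal)
  rw [← lintegral_indicator (hY hS), ← lintegral_indicator (hY hS)]
  refine Eq.trans (lintegral_congr fun ω => ?_) (e.trans (lintegral_congr fun ω => ?_))
  · simp only [Set.indicator_apply, Set.mem_preimage, Pi.one_apply]
    split_ifs <;> simp
  · simp only [Set.indicator_apply, Set.mem_preimage, Pi.one_apply]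
    split_ifs <;> simp [crit]

end Step

section IsCondLaw

variable {Ω : Type*} {m mΩ : MeasurableSpace Ω} {P : Measure Ω}
  [IsProbabilityMeasure P] {ξ : Ω → C(X, ℝ)} {ν : Ω → GM X} {U : Ω → ℝ} {x : Ω → X}

lemma IsCondLaw.indepFun (hind : Indep (m ⊔ MeasurableSpace.comap ξ inferInstance)
    (MeasurableSpace.comap U inferInstance) P) :
    @IndepFun Ω (Ω × C(X, ℝ)) ℝ mΩ (m.prod inferInstance) _ (fun ω => (ω, ξ ω)) U P := by
  refine (@IndepFun_iff_Indep Ω (Ω × C(X, ℝ)) ℝ mΩ (m.prod inferInstance) _ _ _ P).2 ?_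
  rw [MeasurableSpace.comap_prodMk]
  have h : MeasurableSpace.comap (fun ω : Ω => ω) m = m := MeasurableSpace.comap_id
  rwa [h]

theorem IsCondLaw.condPt (h : IsCondLaw m P ξ ν) (τ : C(X, ℝ≥0)) (hξ : Measurable ξ)
    (hU : Measurable U) (hlaw : P.map U = gaussianReal 0 1)
    (hind : Indep (m ⊔ MeasurableSpace.comap ξ inferInstance)
      (MeasurableSpace.comap U inferInstance) P) (hx : Measurable[m] x) :
    IsCondLaw (m ⊔ MeasurableSpace.comap (fun ω => ξ ω (x ω) + U ω * τ (x ω)) inferInstance) P ξ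
      (fun ω => SUR.condPt τ (x ω) (ξ ω (x ω) + U ω * τ (x ω)) (ν ω)) := by
  have hx' : Measurable x := hx.mono h.le le_rfl
  have hZ : Measurable fun ω => ξ ω (x ω) + U ω * τ (x ω) :=
    (measurable_continuousMap_eval.comp (hξ.prodMk hx')).add
      (hU.mul ((measurable_noise τ).comp hx'))
  refine isCondLaw_of_setLIntegral (sup_le h.le hZ.comap_le) hξ ?_ fun S hS A hA => ?_
  · have h1 : m ≤ m ⊔ MeasurableSpace.comap (fun ω => ξ ω (x ω) + U ω * τ (x ω)) inferInstance :=
      le_sup_left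
    have h2 : MeasurableSpace.comap (fun ω => ξ ω (x ω) + U ω * τ (x ω)) inferInstance ≤
        m ⊔ MeasurableSpace.comap (fun ω => ξ ω (x ω) + U ω * τ (x ω)) inferInstance :=
      le_sup_right
    refine (measurable_condPt τ).comp (Measurable.prodMk (hx.mono h1 le_rfl)
      (Measurable.prodMk ?_ (h.measurable.mono h1 le_rfl)))
    exact (comap_measurable _).mono h2 le_rfl
  · have hcomap : m ⊔ MeasurableSpace.comap (fun ω => ξ ω (x ω) + U ω * τ (x ω)) inferInstance =
        MeasurableSpace.comap (fun ω => (ω, ξ ω (x ω) + U ω * τ (x ω)))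
          (m.prod inferInstance) := by
      have h : MeasurableSpace.comap (fun ω : Ω => ω) m = m := MeasurableSpace.comap_id
      rw [MeasurableSpace.comap_prodMk, h]
    rw [hcomap] at hS
    obtain ⟨T, hT, rfl⟩ := hS
    exact setLIntegral_condPt_prod (mβ := m) (Y := id) (η := ν) (x := x) τ hξ
      (measurable_id'' h.le) h.measurable (fun _ hS _ hA => h.setLIntegral hξ hS hA) hU hlaw
      (IsCondLaw.indepFun hind) hx hT hA

theorem IsCondLaw.setLIntegral_crit (h : IsCondLaw m P ξ ν) (τ : C(X, ℝ≥0)) (hξ : Measurable ξ)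
    (hU : Measurable U) (hlaw : P.map U = gaussianReal 0 1)
    (hind : Indep (m ⊔ MeasurableSpace.comap ξ inferInstance)
      (MeasurableSpace.comap U inferInstance) P) (hx : Measurable[m] x)
    {H : GM X → ℝ≥0} (hH : Measurable H) {S : Set Ω} (hS : MeasurableSet[m] S) :
    ∫⁻ ω in S, H (SUR.condPt τ (x ω) (ξ ω (x ω) + U ω * τ (x ω)) (ν ω)) ∂P
      = ∫⁻ ω in S, crit τ H (x ω) (ν ω) ∂P := by
  exact setLIntegral_crit_prod (mβ := m) (Y := id) (η := ν) (x := x) τ hξ (measurable_id'' h.le)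
    h.measurable (fun _ hS _ hA => h.setLIntegral hξ hS hA) hU hlaw (IsCondLaw.indepFun hind) hx
    hH hS

end IsCondLaw

end

section

variable [MeasurableSpace X] [BorelSpace X]

/-! ### The posterior distributions of a sequential design -/

lemma isCondLaw_const {Ω : Type*} {mΩ : MeasurableSpace Ω} {P : Measure Ω}
    [IsProbabilityMeasure P] {ξ : Ω → C(X, ℝ)} (hξ : Measurable ξ) {ν : GM X}
    (h : P.map ξ = ν.meas) : IsCondLaw ⊥ P ξ fun _ => ν := by
  refine ⟨bot_le, measurable_const, fun A hA => ?_⟩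
  rw [condExp_bot, integral_indicator_const _ (hξ hA)]
  refine Eventually.of_forall fun ω => ?_
  simp [← h, map_measureReal_apply hξ hA]

lemma indepFun_prodMk_of_indepFun {Ω α β γ : Type*} {mΩ : MeasurableSpace Ω}
    [MeasurableSpace α] [MeasurableSpace β] [MeasurableSpace γ] {P : Measure Ω}
    [IsProbabilityMeasure P] {f : Ω → α} {g : Ω → β} {h : Ω → γ} (hf : Measurable f)
    (hg : Measurable g) (hh : Measurable h) (hfgh : IndepFun f (fun ω => (g ω, h ω)) P)
    (hgh : IndepFun g h P) : IndepFun (fun ω => (f ω, g ω)) h P := by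
  have e1 := (indepFun_iff_map_prod_eq_prod_map_map hf.aemeasurable
    (hg.prodMk hh).aemeasurable).1 hfgh
  have e2 := (indepFun_iff_map_prod_eq_prod_map_map hg.aemeasurable hh.aemeasurable).1 hgh
  have hfg : IndepFun f g P := hfgh.comp measurable_id measurable_fst
  have e3 := (indepFun_iff_map_prod_eq_prod_map_map hf.aemeasurable hg.aemeasurable).1 hfg
  rw [indepFun_iff_map_prod_eq_prod_map_map (hf.prodMk hg).aemeasurable hh.aemeasurable, e3]
  have : IsProbabilityMeasure (P.map f) := Measure.isProbabilityMeasure_map hf.aemeasurable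
  have : IsProbabilityMeasure (P.map g) := Measure.isProbabilityMeasure_map hg.aemeasurable
  have : IsProbabilityMeasure (P.map h) := Measure.isProbabilityMeasure_map hh.aemeasurable
  refine (MeasurableEquiv.prodAssoc (α := α) (β := β) (γ := γ)).map_measurableEquiv_injective ?_
  rw [Measure.prodAssoc_prod, ← e2, ← e1, Measure.map_map (by fun_prop)
    ((hf.prodMk hg).prodMk hh)]
  rfl

/-- By induction, the first n points and observations are functions of ξ and the first n noises. The
intended 𝒢 is the σ-algebra these generate, from which U_n is independent. -/
lemma obsSigma_le_of_measurable {Ω : Type*} {𝒢 : MeasurableSpace Ω} {τ : C(X, ℝ≥0)}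
    {ξ : Ω → C(X, ℝ)} {U : ℕ → Ω → ℝ} {pt : ℕ → Ω → X}
    (hpt : ∀ n, Measurable[obsSigma τ ξ U pt n] (pt n)) (hξ : Measurable ξ) {n : ℕ}
    (hU : ∀ i < n, Measurable (U i)) : obsSigma τ ξ U pt n ≤ 𝒢 := by
  induction n using Nat.strong_induction_on with
  | _ n ih =>
    refine iSup_le fun i => iSup_le fun hi => ?_
    have hi' : Measurable (pt i) :=
      (hpt i).mono (ih i hi fun j hj => hU j (hj.trans hi)) le_rfl
    refine sup_le hi'.comap_le (Measurable.comap_le ?_)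
    exact (measurable_continuousMap_eval.comp (hξ.prodMk hi')).add
      (((measurable_noise τ).comp hi').mul (hU i hi))

namespace SeqDesign

variable {τ : C(X, ℝ≥0)} {ν₀ : GM X} {Ω : Type w} [mΩ : MeasurableSpace Ω] {P : Measure Ω}
  [IsProbabilityMeasure P]

lemma isGaussian_map (D : SeqDesign τ ν₀ Ω P) : IsGaussian (P.map D.ξ) := by
  rw [D.law_ξ]; infer_instance

lemma sigma_succ (D : SeqDesign τ ν₀ Ω P) (n : ℕ) :
    D.sigma (n + 1) = D.sigma n ⊔ MeasurableSpace.comap (D.Z n) inferInstance := by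
  have h1 : D.sigma (n + 1) = D.sigma n ⊔ (MeasurableSpace.comap (D.pt n) inferInstance ⊔
      MeasurableSpace.comap (D.Z n) inferInstance) := by
    simp only [sigma, obsSigma, Nat.lt_succ_iff_lt_or_eq, iSup_or, iSup_sup_eq, iSup_iSup_eq_left]
    exact sup_sup_sup_comm _ _ _ _
  rw [h1, ← sup_assoc, sup_eq_left.2 (D.measurable_pt n).comap_le]

lemma indep_sigma (D : SeqDesign τ ν₀ Ω P) (n : ℕ) :
    Indep (D.sigma n ⊔ MeasurableSpace.comap D.ξ inferInstance)
      (MeasurableSpace.comap (D.U n) inferInstance) P := by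
  let V : Ω → (Finset.range n → ℝ) := fun ω i => D.U i ω
  have hV : Measurable V := measurable_pi_lambda _ fun i => D.measurable_U i
  have h1 : IndepFun V (D.U n) P := by
    have h := D.iIndepFun_U.indepFun_finset (Finset.range n) {n} (by simp) D.measurable_U
    exact h.comp measurable_id (measurable_pi_apply (⟨n, by simp⟩ : ({n} : Finset ℕ)))
  have h2 : IndepFun D.ξ (fun ω => (V ω, D.U n ω)) P := by
    have hm : Measurable fun u : ℕ → ℝ => ((fun i : Finset.range n => u i), u n) := by fun_prop
    exact D.indepFun_ξ_U.comp measurable_id hm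
  have h3 := indepFun_prodMk_of_indepFun D.measurable_ξ hV (D.measurable_U n) h2 h1
  rw [IndepFun_iff_Indep] at h3
  refine indep_of_indep_of_le_left h3 (sup_le
    (obsSigma_le_of_measurable D.measurable_pt ?_ fun i hi => ?_) ?_)
  · exact measurable_fst.comp (comap_measurable fun ω => (D.ξ ω, V ω))
  · exact (measurable_pi_apply (⟨i, by simpa using hi⟩ : Finset.range n)).comp
      (measurable_snd.comp (comap_measurable fun ω => (D.ξ ω, V ω)))
  · exact (measurable_fst.comp (comap_measurable fun ω => (D.ξ ω, V ω))).comap_le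

lemma Z_eq (D : SeqDesign τ ν₀ Ω P) (n : ℕ) :
    D.Z n = fun ω => D.ξ ω (D.pt n ω) + D.U n ω * τ (D.pt n ω) := by
  ext ω
  simp [Z, obs, mul_comm]

theorem isCondLaw_posterior (D : SeqDesign τ ν₀ Ω P) (n : ℕ) :
    IsCondLaw (D.sigma n) P D.ξ (D.posterior n) := by
  induction n with
  | zero =>
    have h0 : D.sigma 0 = ⊥ := by simp [sigma, obsSigma]
    rw [h0]
    exact isCondLaw_const D.measurable_ξ D.law_ξ
  | succ n ih =>
    have h := ih.condPt τ D.measurable_ξ (D.measurable_U n) (D.law_U n) (D.indep_sigma n)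
      (D.measurable_pt n)
    rw [sigma_succ, Z_eq]
    convert h using 2
    rw [posterior, Z_eq]

lemma setLIntegral_posterior_succ (D : SeqDesign τ ν₀ Ω P) {H : GM X → ℝ≥0} (hH : Measurable H)
    (n : ℕ) {S : Set Ω} (hS : MeasurableSet[D.sigma n] S) :
    ∫⁻ ω in S, H (D.posterior (n + 1) ω) ∂P =
      ∫⁻ ω in S, crit τ H (D.pt n ω) (D.posterior n ω) ∂P := by
  rw [← (D.isCondLaw_posterior n).setLIntegral_crit τ D.measurable_ξ (D.measurable_U n) (D.law_U n)
    (D.indep_sigma n) (D.measurable_pt n) hH hS]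
  simp_rw [posterior, Z_eq]

/-- The points of the design are replaced by `x` from the time `n` on. -/
def stopAt (D : SeqDesign τ ν₀ Ω P) (n : ℕ) (x : X) : SeqDesign τ ν₀ Ω P where
  ξ := D.ξ
  U := D.U
  pt i := if i < n then D.pt i else fun _ => x
  measurable_ξ := D.measurable_ξ
  law_ξ := D.law_ξ
  measurable_U := D.measurable_U
  law_U := D.law_U
  iIndepFun_U := D.iIndepFun_U
  indepFun_ξ_U := D.indepFun_ξ_U
  measurable_pt i := by
    split_ifs with h
    · refine (D.measurable_pt i).mono (iSup_mono fun j => iSup_mono fun hj => ?_) le_rfl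
      unfold obs
      simp only [if_pos (hj.trans h), le_refl]
    · exact measurable_const

lemma stopAt_pt_of_lt (D : SeqDesign τ ν₀ Ω P) {n i : ℕ} (x : X) (h : i < n) :
    (D.stopAt n x).pt i = D.pt i := if_pos h

lemma stopAt_pt_self (D : SeqDesign τ ν₀ Ω P) (n : ℕ) (x : X) :
    (D.stopAt n x).pt n = fun _ => x := if_neg (lt_irrefl n)

lemma stopAt_posterior (D : SeqDesign τ ν₀ Ω P) {n i : ℕ} (x : X) (h : i ≤ n) :
    (D.stopAt n x).posterior i = D.posterior i := by
  induction i with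
  | zero => rfl
  | succ i ih =>
    ext1 ω
    rw [posterior, posterior, ih (Nat.le_of_succ_le h), Z_eq, Z_eq, D.stopAt_pt_of_lt x h]
    rfl

lemma stopAt_sigma (D : SeqDesign τ ν₀ Ω P) {n i : ℕ} (x : X) (h : i ≤ n) :
    (D.stopAt n x).sigma i = D.sigma i := by
  induction i with
  | zero => simp [sigma, obsSigma]
  | succ i ih =>
    rw [sigma_succ, sigma_succ, ih (Nat.le_of_succ_le h), Z_eq, Z_eq, D.stopAt_pt_of_lt x h]
    rfl

end SeqDesign

end

/-! ### Integrals of functionals of conditional distributions -/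

section Functional

variable {Ω : Type w} {m mΩ : MeasurableSpace Ω} {P : Measure Ω} [IsProbabilityMeasure P]
  {ξ : Ω → C(X, ℝ)} {ν ν' : Ω → GM X} {H : GM X → ℝ≥0} {L₀ : C(X, ℝ) → ℝ} {H₁ : GM X → ℝ}

lemma CondUniformIntegrable.integrable (hui : CondUniformIntegrable.{u, w} H₁)
    (hξ : Measurable ξ) (hG : IsGaussian (P.map ξ)) (h : IsCondLaw m P ξ ν) :
    Integrable (fun ω => H₁ (ν ω)) P := by
  have h1 := hui Ω P ξ hξ hG
  exact memLp_one_iff_integrable.1 (h1.memLp ⟨ν, m, h⟩)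

/-- Vitali's theorem. The σ-algebras need not be nested, which matters for `tendsto_crit`. -/
lemma tendsto_setIntegral_of_tendstoGM (hui : CondUniformIntegrable.{u, w} H₁)
    (hcont : CondContinuous.{u, w} H₁) (hξ : Measurable ξ) (hG : IsGaussian (P.map ξ))
    {ℱ : ℕ → MeasurableSpace Ω} {νs : ℕ → Ω → GM X} (hν : ∀ n, IsCondLaw (ℱ n) P ξ (νs n))
    (hν' : IsCondLaw m P ξ ν') (ht : ∀ᵐ ω ∂P, GM.TendstoGM (fun n => νs n ω) (ν' ω)) (S : Set Ω) :
    Tendsto (fun n => ∫ ω in S, H₁ (νs n ω) ∂P) atTop (𝓝 (∫ ω in S, H₁ (ν' ω) ∂P)) := by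
  have hU := hui Ω P ξ hξ hG
  have hae := hcont Ω P ξ hξ hG νs ν' (fun n => ⟨ℱ n, hν n⟩) ⟨m, hν'⟩ ht
  have hi := fun n => hui.integrable hξ hG (hν n)
  have hi' := hui.integrable hξ hG hν'
  refine tendsto_setIntegral_of_L1' _ hi'.1 (Eventually.of_forall hi) ?_ S
  refine tendsto_Lp_finite_of_tendsto_ae le_rfl ENNReal.one_ne_top (fun n => (hi n).1)
    (memLp_one_iff_integrable.2 hi') ?_ hae
  intro ε hε
  obtain ⟨δ, hδ, h⟩ := hU.2.1 hε
  exact ⟨δ, hδ, fun n => h ⟨νs n, ℱ n, hν n⟩⟩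

lemma IsCondLaw.integrable_integral (h : IsCondLaw m P ξ ν) (hξ : Measurable ξ)
    (hL₀ : Measurable L₀) (hint : Integrable (fun ω => L₀ (ξ ω)) P) :
    Integrable (fun ω => ∫ f, L₀ f ∂(ν ω).meas) P :=
  integrable_condExp.congr (h.condExp_ae_eq hξ hL₀.stronglyMeasurable hint)

/-- The right side does not involve the conditioning σ-algebra, so the H₀ part needs no continuity
of L₀. -/
lemma IsCondLaw.setIntegral_integral (h : IsCondLaw m P ξ ν) (hξ : Measurable ξ)
    (hL₀ : Measurable L₀) (hint : Integrable (fun ω => L₀ (ξ ω)) P) {S : Set Ω}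
    (hS : MeasurableSet[m] S) :
    ∫ ω in S, ∫ f, L₀ f ∂(ν ω).meas ∂P = ∫ ω in S, L₀ (ξ ω) ∂P := by
  rw [← setIntegral_condExp h.le hint hS]
  refine setIntegral_congr_ae (h.le _ hS) ?_
  filter_upwards [h.condExp_ae_eq hξ hL₀.stronglyMeasurable hint] with ω hω _ using hω.symm

/-- The uncertainty functional `H = H₀ + H₁` with `H₀(ν) = ∫ L₀ dν`. -/
structure IsDecomposition (H : GM X → ℝ≥0) (L₀ : C(X, ℝ) → ℝ) (H₁ : GM X → ℝ) : Prop where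
  measurable_H : Measurable H
  measurable_L₀ : Measurable L₀
  integrable : ∀ ν : GM X, Integrable L₀ ν.meas
  eq : ∀ ν : GM X, (H ν : ℝ) = ∫ f, L₀ f ∂ν.meas + H₁ ν

lemma IsDecomposition.integrable_comp (hd : IsDecomposition H L₀ H₁) (hξ : Measurable ξ)
    (hG : IsGaussian (P.map ξ)) : Integrable (fun ω => L₀ (ξ ω)) P :=
  (hd.integrable ⟨P.map ξ, hG⟩).comp_measurable hξ

lemma IsDecomposition.integrable_functional (hd : IsDecomposition H L₀ H₁)
    (hui : CondUniformIntegrable.{u, w} H₁) (hξ : Measurable ξ) (hG : IsGaussian (P.map ξ))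
    (h : IsCondLaw m P ξ ν) : Integrable (fun ω => (H (ν ω) : ℝ)) P := by
  simp_rw [hd.eq]
  exact (h.integrable_integral hξ hd.measurable_L₀ (hd.integrable_comp hξ hG)).add
    (hui.integrable hξ hG h)

lemma IsDecomposition.setIntegral (hd : IsDecomposition H L₀ H₁)
    (hui : CondUniformIntegrable.{u, w} H₁) (hξ : Measurable ξ) (hG : IsGaussian (P.map ξ))
    (h : IsCondLaw m P ξ ν) {S : Set Ω} (hS : MeasurableSet[m] S) :
    ∫ ω in S, (H (ν ω) : ℝ) ∂P = ∫ ω in S, L₀ (ξ ω) ∂P + ∫ ω in S, H₁ (ν ω) ∂P := by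
  have hint := hd.integrable_comp hξ hG
  simp_rw [hd.eq]
  rw [integral_add (h.integrable_integral hξ hd.measurable_L₀ hint).integrableOn
    (hui.integrable hξ hG h).integrableOn, h.setIntegral_integral hξ hd.measurable_L₀ hint hS]

lemma IsDecomposition.setLIntegral (hd : IsDecomposition H L₀ H₁)
    (hui : CondUniformIntegrable.{u, w} H₁) (hξ : Measurable ξ) (hG : IsGaussian (P.map ξ))
    (h : IsCondLaw m P ξ ν) {S : Set Ω} (hS : MeasurableSet[m] S) :
    ∫⁻ ω in S, H (ν ω) ∂P =
      ENNReal.ofReal (∫ ω in S, L₀ (ξ ω) ∂P + ∫ ω in S, H₁ (ν ω) ∂P) := by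
  rw [← hd.setIntegral hui hξ hG h hS, ofReal_integral_eq_lintegral_ofReal
    (hd.integrable_functional hui hξ hG h).integrableOn
    (Eventually.of_forall fun ω => NNReal.coe_nonneg _)]
  simp

lemma IsDecomposition.tendsto_setLIntegral (hd : IsDecomposition H L₀ H₁)
    (hui : CondUniformIntegrable.{u, w} H₁) (hcont : CondContinuous.{u, w} H₁)
    (hξ : Measurable ξ) (hG : IsGaussian (P.map ξ))
    {ℱ : ℕ → MeasurableSpace Ω} {νs : ℕ → Ω → GM X} (hν : ∀ n, IsCondLaw (ℱ n) P ξ (νs n))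
    (hν' : IsCondLaw m P ξ ν') (ht : ∀ᵐ ω ∂P, GM.TendstoGM (fun n => νs n ω) (ν' ω)) {S : Set Ω}
    (hS : ∀ᶠ n in atTop, MeasurableSet[ℱ n] S) (hS' : MeasurableSet[m] S) :
    Tendsto (fun n => ∫⁻ ω in S, H (νs n ω) ∂P) atTop (𝓝 (∫⁻ ω in S, H (ν' ω) ∂P)) := by
  rw [hd.setLIntegral hui hξ hG hν' hS']
  refine Tendsto.congr' (hS.mono fun n hn => (hd.setLIntegral hui hξ hG (hν n) hn).symm) ?_
  exact ENNReal.tendsto_ofReal (tendsto_const_nhds.add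
    (tendsto_setIntegral_of_tendstoGM hui hcont hξ hG hν hν' ht S))

end Functional

/-! ### Transport of conditional distributions -/

lemma IsCondLaw.comp_measurePreserving {Ω Ω' : Type*} {m mΩ : MeasurableSpace Ω}
    {mΩ' : MeasurableSpace Ω'} {P : Measure Ω} {P' : Measure Ω'} [IsProbabilityMeasure P]
    [IsProbabilityMeasure P'] {ξ : Ω → C(X, ℝ)} {ν : Ω → GM X} (h : IsCondLaw m P ξ ν)
    (hξ : Measurable ξ) {φ : Ω' → Ω} (hφ : MeasurePreserving φ P' P) :
    IsCondLaw (m.comap φ) P' (ξ ∘ φ) (ν ∘ φ) := by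
  refine isCondLaw_of_setLIntegral ((MeasurableSpace.comap_mono h.le).trans hφ.measurable.comap_le)
    (hξ.comp hφ.measurable) (h.measurable.comp (comap_measurable φ)) ?_
  rintro _ ⟨S, hS, rfl⟩ A hA
  have h1 := hφ.setLIntegral_comp_preimage (h.le _ hS) (measurable_meas_apply h.measurable' hA)
  refine h1.trans ?_
  rw [h.setLIntegral hξ hS hA, Set.preimage_comp, ← Set.preimage_inter,
    hφ.measure_preimage ((h.le _ hS).inter (hξ hA)).nullMeasurableSet]

/-- The hypotheses on H₁ concern probability spaces in universe `w`, whereas C(X) lives in `u`. A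
Borel embedding into ℝ moves the law to a lifted copy of ℝ. -/
lemma exists_probabilitySpace_map_eq {α : Type*} [MeasurableSpace α] [StandardBorelSpace α]
    (Q : Measure α) [IsProbabilityMeasure Q] :
    ∃ (Ω : Type w) (_ : MeasurableSpace Ω) (P : Measure Ω) (_ : IsProbabilityMeasure P)
      (V : Ω → α), Measurable V ∧ P.map V = Q := by
  obtain ⟨e, he⟩ := exists_measurableEmbedding_real α
  have hne : Nonempty α := nonempty_of_isProbabilityMeasure Q
  obtain ⟨g, hg, hge⟩ := he.exists_measurable_extend measurable_id fun _ => hne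
  have hm : Measurable fun a => ULift.up.{w} (e a) :=
    MeasurableEquiv.ulift.symm.measurable.comp he.measurable
  have hm' : Measurable (g ∘ ULift.down.{w}) := hg.comp MeasurableEquiv.ulift.measurable
  refine ⟨ULift.{w} ℝ, inferInstance, Q.map fun a => ULift.up (e a),
    Measure.isProbabilityMeasure_map hm.aemeasurable, g ∘ ULift.down,
    hm', ?_⟩
  rw [Measure.map_map hm' hm]
  have : (g ∘ ULift.down) ∘ (fun a => ULift.up.{w} (e a)) = id := hge
  rw [this, Measure.map_id]

/-- The union of the ℱ_n is a π-system generating ⨆ ℱ_n, and the measures with densities f and g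
agree on it, the first being finite. -/
lemma ae_eq_of_setLIntegral_eq_iSup {Ω : Type*} {mΩ : MeasurableSpace Ω} {P : Measure Ω}
    [IsProbabilityMeasure P] (ℱ : Filtration ℕ mΩ) {f g : Ω → ℝ≥0∞}
    (hf : Measurable[⨆ n, ℱ n] f) (hg : Measurable[⨆ n, ℱ n] g) (hfin : ∫⁻ ω, f ω ∂P ≠ ∞)
    (h : ∀ n S, MeasurableSet[ℱ n] S → ∫⁻ ω in S, f ω ∂P = ∫⁻ ω in S, g ω ∂P) :
    f =ᵐ[P] g := by
  have hle : ⨆ n, ℱ n ≤ mΩ := iSup_le ℱ.le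
  have hpi : IsPiSystem {s | ∃ n, MeasurableSet[ℱ n] s} := by
    rw [Set.ofPred_exists]
    exact isPiSystem_iUnion_of_monotone _ (fun n ↦ (ℱ n).isPiSystem_measurableSet)
      fun _ _ ↦ ℱ.mono
  have : IsFiniteMeasure (P.withDensity f) := isFiniteMeasure_withDensity hfin
  have key : ∀ S, MeasurableSet[⨆ n, ℱ n] S → ∫⁻ ω in S, f ω ∂P = ∫⁻ ω in S, g ω ∂P := by
    intro S hS
    rw [← withDensity_apply _ (hle _ hS), ← withDensity_apply _ (hle _ hS)]
    refine ext_on_measurableSpace_of_generate_finite mΩ _ ?_ hle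
      (MeasurableSpace.measurableSpace_iSup_eq ℱ) hpi ?_ hS
    · rintro s ⟨n, hn⟩
      rw [withDensity_apply _ (ℱ.le n _ hn), withDensity_apply _ (ℱ.le n _ hn), h n s hn]
    · rw [withDensity_apply _ MeasurableSet.univ, withDensity_apply _ MeasurableSet.univ]
      exact h 0 _ MeasurableSet.univ
  refine ae_eq_of_ae_eq_trim (hm := hle) ?_
  refine ae_eq_of_forall_setLIntegral_eq_of_sigmaFinite₀ hf.aemeasurable hg.aemeasurable
    fun s hs _ => ?_
  rw [restrict_trim hle _ hs, lintegral_trim hle hf, lintegral_trim hle hg, key s hs]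

/-! ### Continuity of the sampling criterion at a fixed Gaussian measure -/

lemma GM.covC_curry (ν : GM X) (x y : X) : ν.covC.curry x y = ν.cov y x := by
  rw [ContinuousMap.curry_apply, GM.covC_apply]
  exact covariance_comm _ _

lemma continuous_predVar (τ : C(X, ℝ≥0)) (ν : GM X) : Continuous (predVar τ ν) := by
  have h : predVar τ ν = fun x => ν.covC (x, x) + (τ x : ℝ) ^ 2 := by
    ext x
    rw [GM.covC_apply, predVar]
  rw [h]
  fun_prop

lemma continuousAt_gainFun (τ : C(X, ℝ≥0)) (ν : GM X) {x : X} (hx : predVar τ ν x ≠ 0) :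
    ContinuousAt (gainFun τ ν) x := by
  have h : gainFun τ ν = fun x => (predVar τ ν x)⁻¹ • ν.covC.curry x := by
    ext x y
    rw [ContinuousMap.smul_apply, GM.covC_curry, smul_eq_mul, inv_mul_eq_div]
    rfl
  rw [h]
  exact ((continuous_predVar τ ν).continuousAt.inv₀ hx).smul
    ν.covC.curry.continuous.continuousAt

lemma meanC_condPt (τ : C(X, ℝ≥0)) (x : X) (z : ℝ) (ν : GM X) :
    (condPt τ x z ν).meanC = ν.meanC + (z - ν.meanC x) • gainFun τ ν x := by
  ext y
  simp only [GM.meanC_apply, mean_condPt, ContinuousMap.add_apply, ContinuousMap.smul_apply,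
    smul_eq_mul, gainFun, ContinuousMap.coe_mk]
  ring

lemma covC_condPt (τ : C(X, ℝ≥0)) (x : X) (z : ℝ) (ν : GM X) :
    (condPt τ x z ν).covC = ν.covC - predVar τ ν x • tensorSq (gainFun τ ν x) := by
  ext ⟨y, y'⟩
  have h1 := predVar_mul_gainFun τ ν x y
  have h2 : ν.cov x y' = ν.cov y' x := covariance_comm _ _
  simp only [GM.covC_apply, cov_condPt, ContinuousMap.sub_apply, ContinuousMap.smul_apply,
    smul_eq_mul, tensorSq, ContinuousMap.mul_apply, ContinuousMap.comp_apply,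
    ContinuousMap.fst_apply, ContinuousMap.snd_apply]
  rw [← mul_assoc, h1, h2, mul_div_assoc]
  rfl

lemma tendstoGM_condPt (τ : C(X, ℝ≥0)) (ν : GM X) {x : X} (hx : predVar τ ν x ≠ 0) {xs : ℕ → X}
    (hxs : Tendsto xs atTop (𝓝 x)) {zs : ℕ → ℝ} {z : ℝ} (hzs : Tendsto zs atTop (𝓝 z)) :
    GM.TendstoGM (fun n => condPt τ (xs n) (zs n) ν) (condPt τ x z ν) := by
  have hg : Tendsto (fun n => gainFun τ ν (xs n)) atTop (𝓝 (gainFun τ ν x)) :=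
    (continuousAt_gainFun τ ν hx).tendsto.comp hxs
  rw [tendstoGM_iff]
  simp_rw [meanC_condPt, covC_condPt]
  constructor
  · exact tendsto_const_nhds.add
      ((hzs.sub ((ν.meanC.continuous.tendsto x).comp hxs)).smul hg)
  · exact tendsto_const_nhds.sub ((((continuous_predVar τ ν).tendsto x).comp hxs).smul
      ((continuous_tensorSq.tendsto _).comp hg))

lemma crit_eq_of_predVar_eq_zero {τ : C(X, ℝ≥0)} {ν : GM X} {x : X} (h : predVar τ ν x = 0)
    (H : GM X → ℝ≥0) : crit τ H x ν = H ν := by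
  unfold crit
  simp [condPt_eq_self h]

section

variable [MeasurableSpace X] [BorelSpace X]

/-- Realize ν and an independent noise on one space. The laws updated by an observation at `xs n`
are all conditional laws of the same ξ, and the updating formulas are continuous where the
predictive variance is nonzero, so they converge for every ω; the criterion is the mean of H over
them. -/
theorem tendsto_crit {H : GM X → ℝ≥0} {L₀ : C(X, ℝ) → ℝ} {H₁ : GM X → ℝ}
    (hd : IsDecomposition H L₀ H₁) (hui : CondUniformIntegrable.{u, w} H₁)
    (hcont : CondContinuous.{u, w} H₁) (τ : C(X, ℝ≥0)) (ν : GM X) {x : X}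
    (hx : predVar τ ν x ≠ 0) {xs : ℕ → X} (hxs : Tendsto xs atTop (𝓝 x)) :
    Tendsto (fun n => crit τ H (xs n) ν) atTop (𝓝 (crit τ H x ν)) := by
  obtain ⟨Ω, mΩ, P, hP, V, hV, hQ⟩ :=
    exists_probabilitySpace_map_eq.{w} (ν.meas.prod (gaussianReal 0 1))
  let ξ : Ω → C(X, ℝ) := fun ω => (V ω).1
  let U : Ω → ℝ := fun ω => (V ω).2
  have hξ : Measurable ξ := measurable_fst.comp hV
  have hU : Measurable U := measurable_snd.comp hV
  have hξl : P.map ξ = ν.meas := by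
    have := Measure.map_map (μ := P) measurable_fst hV
    rw [hQ, Measure.map_fst_prod] at this
    rw [measure_univ, one_smul] at this
    exact this.symm
  have hUl : P.map U = gaussianReal 0 1 := by
    have := Measure.map_map (μ := P) measurable_snd hV
    rw [hQ, Measure.map_snd_prod] at this
    rw [measure_univ, one_smul] at this
    exact this.symm
  have hG : IsGaussian (P.map ξ) := by rw [hξl]; infer_instance
  have hind : Indep (⊥ ⊔ MeasurableSpace.comap ξ inferInstance)
      (MeasurableSpace.comap U inferInstance) P := by
    rw [bot_sup_eq, ← IndepFun_iff_Indep,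
      indepFun_iff_map_prod_eq_prod_map_map hξ.aemeasurable hU.aemeasurable, hξl, hUl]
    exact hQ
  have h0 := isCondLaw_const hξ hξl
  have hc : ∀ x : X, IsCondLaw (⊥ ⊔ MeasurableSpace.comap (fun ω => ξ ω x + U ω * τ x)
      inferInstance) P ξ (fun ω => condPt τ x (ξ ω x + U ω * τ x) ν) := fun x =>
    h0.condPt τ hξ hU hUl hind (x := fun _ => x) measurable_const
  have hcrit : ∀ x : X, ∫⁻ ω in Set.univ, H (condPt τ x (ξ ω x + U ω * τ x) ν) ∂P
      = crit τ H x ν := fun x => by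
    rw [h0.setLIntegral_crit τ hξ hU hUl hind (x := fun _ => x) measurable_const hd.measurable_H
      MeasurableSet.univ]
    simp
  have ht : ∀ᵐ ω ∂P, GM.TendstoGM (fun n => condPt τ (xs n) (ξ ω (xs n) + U ω * τ (xs n)) ν)
      (condPt τ x (ξ ω x + U ω * τ x) ν) := Eventually.of_forall fun ω => by
    have hcz : Continuous fun y => ξ ω y + U ω * τ y := by fun_prop
    exact tendstoGM_condPt τ ν hx hxs ((hcz.tendsto x).comp hxs)
  have := hd.tendsto_setLIntegral hui hcont hξ hG (fun n => hc (xs n)) (hc x) ht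
    (S := Set.univ) (Eventually.of_forall fun n => MeasurableSet.univ) MeasurableSet.univ
  simpa only [hcrit] using this

/-- Continuity is available only where the predictive variance is nonzero; elsewhere the observation
leaves ν unchanged and equality is immediate. -/
theorem crit_eq_of_dense {H : GM X → ℝ≥0} {L₀ : C(X, ℝ) → ℝ} {H₁ : GM X → ℝ}
    (hd : IsDecomposition H L₀ H₁) (hui : CondUniformIntegrable.{u, w} H₁)
    (hcont : CondContinuous.{u, w} H₁) (τ : C(X, ℝ≥0)) (ν : GM X) {d : ℕ → X} (hdense : DenseRange d)
    (h : ∀ j, crit τ H (d j) ν = H ν) (x : X) : crit τ H x ν = H ν := by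
  by_cases hx : predVar τ ν x = 0
  · exact crit_eq_of_predVar_eq_zero hx H
  obtain ⟨s, hs, hsx⟩ := mem_closure_iff_seq_limit.1 (hdense x)
  choose j hj using hs
  refine tendsto_nhds_unique (tendsto_crit hd hui hcont τ ν hx hsx) ?_
  simp only [← hj, h, tendsto_const_nhds]

end

section

variable [MeasurableSpace X] [BorelSpace X]

/-! ### Extension of the probability space by an independent noise variable -/

section Extension

variable {Ω : Type*} {m mΩ : MeasurableSpace Ω} {P : Measure Ω} [IsProbabilityMeasure P]
  {ξ : Ω → C(X, ℝ)} {ν : Ω → GM X}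

lemma indep_snd (hm : m ≤ mΩ) (hξ : Measurable ξ) :
    Indep (m.comap (Prod.fst : Ω × ℝ → Ω) ⊔
        MeasurableSpace.comap (ξ ∘ (Prod.fst : Ω × ℝ → Ω)) inferInstance)
      (MeasurableSpace.comap (Prod.snd : Ω × ℝ → ℝ) inferInstance)
      (P.prod (gaussianReal 0 1)) := by
  have h : Indep (mΩ.comap (Prod.fst : Ω × ℝ → Ω))
      (MeasurableSpace.comap (Prod.snd : Ω × ℝ → ℝ) inferInstance)
      (P.prod (gaussianReal 0 1)) := by
    refine (IndepFun_iff_Indep _ _ _).1 ?_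
    rw [indepFun_iff_map_prod_eq_prod_map_map measurable_fst.aemeasurable
      measurable_snd.aemeasurable, (measurePreserving_fst).map_eq, (measurePreserving_snd).map_eq]
    exact Measure.map_id
  refine indep_of_indep_of_le_left h (sup_le (MeasurableSpace.comap_mono hm) ?_)
  exact (hξ.comp (comap_measurable _)).comap_le

/-- The second coordinate of Ω × ℝ is a fresh noise, which allows a virtual observation at x on top
of any conditional law, including the one given ℱ_∞. -/
lemma IsCondLaw.condPt_snd (h : IsCondLaw m P ξ ν) (hξ : Measurable ξ) (τ : C(X, ℝ≥0)) (x : X) :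
    IsCondLaw (m.comap (Prod.fst : Ω × ℝ → Ω) ⊔
        MeasurableSpace.comap (fun p : Ω × ℝ => ξ p.1 x + p.2 * τ x) inferInstance)
      (P.prod (gaussianReal 0 1)) (ξ ∘ Prod.fst)
      (fun p => SUR.condPt τ x (ξ p.1 x + p.2 * τ x) (ν p.1)) :=
  (h.comp_measurePreserving hξ measurePreserving_fst).condPt τ (hξ.comp measurable_fst)
    measurable_snd measurePreserving_snd.map_eq (indep_snd h.le hξ) (x := fun _ => x)
    measurable_const

lemma IsCondLaw.setLIntegral_crit_snd (h : IsCondLaw m P ξ ν) (hξ : Measurable ξ)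
    (τ : C(X, ℝ≥0)) (x : X) {H : GM X → ℝ≥0} (hH : Measurable H) {S : Set Ω}
    (hS : MeasurableSet[m] S) :
    ∫⁻ p in Prod.fst ⁻¹' S, H (SUR.condPt τ x (ξ p.1 x + p.2 * τ x) (ν p.1))
        ∂(P.prod (gaussianReal 0 1)) = ∫⁻ ω in S, crit τ H x (ν ω) ∂P := by
  refine ((h.comp_measurePreserving hξ measurePreserving_fst).setLIntegral_crit τ
    (hξ.comp measurable_fst) measurable_snd measurePreserving_snd.map_eq (indep_snd h.le hξ)
    (x := fun _ => x) measurable_const hH ⟨S, hS, rfl⟩).trans ?_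
  exact measurePreserving_fst.setLIntegral_comp_preimage (h.le _ hS)
    ((measurable_crit τ hH).comp (measurable_const.prodMk h.measurable'))

end Extension

/-! ### Convergence of quasi-SUR designs -/

namespace SeqDesign

variable {τ : C(X, ℝ≥0)} {ν₀ : GM X} {Ω : Type w} [mΩ : MeasurableSpace Ω] {P : Measure Ω}
  [IsProbabilityMeasure P] {H : GM X → ℝ≥0} {L₀ : C(X, ℝ) → ℝ} {H₁ : GM X → ℝ}

/-- The filtration `(ℱ_n)_{n ≥ 0}`. -/
def natFiltration (D : SeqDesign τ ν₀ Ω P) : Filtration ℕ mΩ where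
  seq := D.sigma
  mono' := D.sigma_mono
  le' := D.sigma_le

theorem exists_isCondLaw_sigmaInf (D : SeqDesign τ ν₀ Ω P) :
    ∃ Pinf : Ω → GM X, IsCondLaw D.sigmaInf P D.ξ Pinf :=
  exists_isCondLaw_iSup (ℱ := D.natFiltration) D.measurable_ξ D.isGaussian_map
    D.isCondLaw_posterior

/-- The L₀ parts at times n and n + 1 coincide, since S belongs to ℱ_n, and H₁ decreases in mean.
The condition n > 0 reflects that the supermartingale is indexed from 1. -/
lemma setLIntegral_posterior_succ_le (hd : IsDecomposition H L₀ H₁)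
    (hui : CondUniformIntegrable.{u, w} H₁) (hsuper : SupermartingaleProperty.{u, w} τ H₁)
    (D : SeqDesign τ ν₀ Ω P) {n : ℕ} (hn : 0 < n) {S : Set Ω} (hS : MeasurableSet[D.sigma n] S) :
    ∫⁻ ω in S, H (D.posterior (n + 1) ω) ∂P ≤ ∫⁻ ω in S, H (D.posterior n ω) ∂P := by
  have hS' : MeasurableSet[D.sigma (n + 1)] S := D.sigma_mono n.le_succ _ hS
  rw [hd.setLIntegral hui D.measurable_ξ D.isGaussian_map (D.isCondLaw_posterior n) hS,
    hd.setLIntegral hui D.measurable_ξ D.isGaussian_map (D.isCondLaw_posterior (n + 1)) hS']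
  have h := (hsuper Ω P ν₀ D).setIntegral_le (i := ⟨n, hn⟩) (j := ⟨n + 1, n.succ_pos⟩)
    (Subtype.mk_le_mk.2 n.le_succ) hS
  exact ENNReal.ofReal_le_ofReal (add_le_add_right h _)

/-- The one-step inequality is applied to the design `D.stopAt n x`, which has the same past as `D`
up to time n and observes next at x. -/
lemma setLIntegral_crit_le (hd : IsDecomposition H L₀ H₁)
    (hui : CondUniformIntegrable.{u, w} H₁) (hsuper : SupermartingaleProperty.{u, w} τ H₁)
    (D : SeqDesign τ ν₀ Ω P) (x : X) {n : ℕ} (hn : 0 < n) {S : Set Ω}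
    (hS : MeasurableSet[D.sigma n] S) :
    ∫⁻ ω in S, crit τ H x (D.posterior n ω) ∂P ≤ ∫⁻ ω in S, H (D.posterior n ω) ∂P := by
  have hS' : MeasurableSet[(D.stopAt n x).sigma n] S := by rwa [D.stopAt_sigma x le_rfl]
  have h := setLIntegral_posterior_succ_le hd hui hsuper (D.stopAt n x) hn hS'
  rw [(D.stopAt n x).setLIntegral_posterior_succ hd.measurable_H n hS',
    D.stopAt_posterior x le_rfl, D.stopAt_pt_self] at h
  exact h

/-- The sampling criterion at a fixed point converges in mean along the design. -/
lemma tendsto_setLIntegral_crit (hd : IsDecomposition H L₀ H₁)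
    (hui : CondUniformIntegrable.{u, w} H₁) (hcont : CondContinuous.{u, w} H₁)
    (D : SeqDesign τ ν₀ Ω P) {Pinf : Ω → GM X} (hP : IsCondLaw D.sigmaInf P D.ξ Pinf) (x : X)
    {k : ℕ} {S : Set Ω} (hS : MeasurableSet[D.sigma k] S) :
    Tendsto (fun n => ∫⁻ ω in S, crit τ H x (D.posterior n ω) ∂P) atTop
      (𝓝 (∫⁻ ω in S, crit τ H x (Pinf ω) ∂P)) := by
  have hξ : Measurable (D.ξ ∘ (Prod.fst : Ω × ℝ → Ω)) := D.measurable_ξ.comp measurable_fst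
  have hG : IsGaussian ((P.prod (gaussianReal 0 1)).map (D.ξ ∘ (Prod.fst : Ω × ℝ → Ω))) := by
    rw [← Measure.map_map D.measurable_ξ measurable_fst, measurePreserving_fst.map_eq]
    exact D.isGaussian_map
  let Z : Ω × ℝ → ℝ := fun p => D.ξ p.1 x + p.2 * τ x
  have hn := fun n => (D.isCondLaw_posterior n).condPt_snd D.measurable_ξ τ x
  have hi := hP.condPt_snd D.measurable_ξ τ x
  -- The virtual observation is known from the start, so these σ-algebras increase to ℱ_∞ ∨ σ(Z) and
  -- Lévy's theorem applies to the posteriors updated at x.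
  let 𝒢 : Filtration ℕ (inferInstance : MeasurableSpace (Ω × ℝ)) :=
    { seq := fun n => (D.sigma n).comap Prod.fst ⊔ MeasurableSpace.comap Z inferInstance
      mono' := fun i j hij => sup_le_sup_right (MeasurableSpace.comap_mono (D.sigma_mono hij)) _
      le' := fun n => (hn n).le }
  have hsup : ⨆ n, 𝒢 n =
      D.sigmaInf.comap Prod.fst ⊔ MeasurableSpace.comap Z inferInstance := by
    rw [sigmaInf, MeasurableSpace.comap_iSup, iSup_sup]
  have ht := IsCondLaw.ae_tendstoGM (ℱ := 𝒢) hξ hG hn (hsup ▸ hi)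
  have hSn : ∀ n ≥ k, MeasurableSet[D.sigma n] S := fun n hn => D.sigma_mono hn _ hS
  have hSinf : MeasurableSet[D.sigmaInf] S := le_iSup D.sigma k _ hS
  have hlim := hd.tendsto_setLIntegral hui hcont hξ hG
    hn hi ht (S := Prod.fst ⁻¹' S)
    ((eventually_ge_atTop k).mono fun n hn =>
      MeasurableSpace.measurableSet_sup.2 (.basic _ (Or.inl ⟨S, hSn n hn, rfl⟩)))
    (MeasurableSpace.measurableSet_sup.2 (.basic _ (Or.inl ⟨S, hSinf, rfl⟩)))
  rw [hP.setLIntegral_crit_snd D.measurable_ξ τ x hd.measurable_H hSinf] at hlim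
  exact hlim.congr' ((eventually_ge_atTop k).mono fun n hn =>
    (D.isCondLaw_posterior n).setLIntegral_crit_snd D.measurable_ξ τ x hd.measurable_H (hSn n hn))

lemma tendsto_setLIntegral_posterior (hd : IsDecomposition H L₀ H₁)
    (hui : CondUniformIntegrable.{u, w} H₁) (hcont : CondContinuous.{u, w} H₁)
    (D : SeqDesign τ ν₀ Ω P) {Pinf : Ω → GM X} (hP : IsCondLaw D.sigmaInf P D.ξ Pinf)
    {k : ℕ} {S : Set Ω} (hS : MeasurableSet[D.sigma k] S) :
    Tendsto (fun n => ∫⁻ ω in S, H (D.posterior n ω) ∂P) atTop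
      (𝓝 (∫⁻ ω in S, H (Pinf ω) ∂P)) :=
  hd.tendsto_setLIntegral hui hcont D.measurable_ξ D.isGaussian_map D.isCondLaw_posterior hP
    (IsCondLaw.ae_tendstoGM (ℱ := D.natFiltration) D.measurable_ξ D.isGaussian_map
      D.isCondLaw_posterior hP)
    ((eventually_ge_atTop k).mono fun _ hn => D.sigma_mono hn _ hS) (le_iSup D.sigma k _ hS)

lemma setLIntegral_crit_eq (hd : IsDecomposition H L₀ H₁)
    (hui : CondUniformIntegrable.{u, w} H₁) (hcont : CondContinuous.{u, w} H₁)
    (hsuper : SupermartingaleProperty.{u, w} τ H₁)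
    (D : SeqDesign τ ν₀ Ω P) (hD : D.IsQuasiSUR H) {Pinf : Ω → GM X}
    (hP : IsCondLaw D.sigmaInf P D.ξ Pinf) (x : X) {k : ℕ} {S : Set Ω}
    (hS : MeasurableSet[D.sigma k] S) :
    ∫⁻ ω in S, H (Pinf ω) ∂P = ∫⁻ ω in S, crit τ H x (Pinf ω) ∂P := by
  obtain ⟨ε, hε0, hε, n₀, hn₀⟩ := hD
  have hSm : MeasurableSet S := D.sigma_le k _ hS
  have hA := tendsto_setLIntegral_posterior hd hui hcont D hP hS
  have hAc := tendsto_setLIntegral_posterior hd hui hcont D hP hS.compl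
  have hAu := tendsto_setLIntegral_posterior hd hui hcont D hP (k := 0) MeasurableSet.univ
  have hB := tendsto_setLIntegral_crit hd hui hcont D hP x hS
  refine le_antisymm ?_ ?_
  -- The quasi-SUR comparison is integrated over all of Ω; on Sᶜ the criterion at x is then replaced
  -- by the larger H(P_n), whose limit is finite and cancels.
  · have hlim : ∫⁻ ω in Set.univ, H (Pinf ω) ∂P ≤
        ∫⁻ ω in S, crit τ H x (Pinf ω) ∂P + ∫⁻ ω in Sᶜ, H (Pinf ω) ∂P + 0 := by
      have hε' : Tendsto (fun n => ENNReal.ofReal (ε n)) atTop (𝓝 0) := by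
        simpa using ENNReal.tendsto_ofReal hε
      refine le_of_tendsto_of_tendsto ((tendsto_add_atTop_iff_nat 1).2 hAu)
        ((hB.add hAc).add hε') ?_
      filter_upwards [eventually_ge_atTop k, eventually_ge_atTop n₀, eventually_gt_atTop 0]
        with n hnk hnn hn0
      have hSn : MeasurableSet[D.sigma n] S := D.sigma_mono hnk _ hS
      have hmeas : Measurable fun ω => crit τ H x (D.posterior n ω) :=
        (measurable_crit τ hd.measurable_H).comp
          (measurable_const.prodMk (D.isCondLaw_posterior n).measurable')
      rw [D.setLIntegral_posterior_succ hd.measurable_H n MeasurableSet.univ,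
        Measure.restrict_univ]
      calc ∫⁻ ω, crit τ H (D.pt n ω) (D.posterior n ω) ∂P
          ≤ ∫⁻ ω, (crit τ H x (D.posterior n ω) + ENNReal.ofReal (ε n)) ∂P :=
            lintegral_mono_ae ((hn₀ n hnn).mono fun ω hω =>
              hω.trans (add_le_add_left (iInf_le _ x) _))
        _ = ∫⁻ ω in S, crit τ H x (D.posterior n ω) ∂P +
            ∫⁻ ω in Sᶜ, crit τ H x (D.posterior n ω) ∂P + ENNReal.ofReal (ε n) := by
            rw [lintegral_add_right _ measurable_const, lintegral_add_compl _ hSm]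
            simp
        _ ≤ _ :=
             add_le_add (add_le_add le_rfl
              (setLIntegral_crit_le hd hui hsuper D x hn0 hSn.compl)) le_rfl
    have hfin : ∫⁻ ω in Sᶜ, H (Pinf ω) ∂P ≠ ∞ := by
      rw [hd.setLIntegral hui D.measurable_ξ D.isGaussian_map hP (le_iSup D.sigma k _ hS.compl)]
      exact ENNReal.ofReal_ne_top
    rw [Measure.restrict_univ, ← lintegral_add_compl _ hSm, add_zero] at hlim
    exact (ENNReal.add_le_add_iff_right hfin).1 hlim
  · refine le_of_tendsto_of_tendsto hB hA ?_
    filter_upwards [eventually_ge_atTop k, eventually_gt_atTop 0] with n hnk hn0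
    exact setLIntegral_crit_le hd hui hsuper D x hn0 (D.sigma_mono hnk _ hS)

theorem ae_crit_eq (hd : IsDecomposition H L₀ H₁)
    (hui : CondUniformIntegrable.{u, w} H₁) (hcont : CondContinuous.{u, w} H₁)
    (hsuper : SupermartingaleProperty.{u, w} τ H₁)
    (D : SeqDesign τ ν₀ Ω P) (hD : D.IsQuasiSUR H) {Pinf : Ω → GM X}
    (hP : IsCondLaw D.sigmaInf P D.ξ Pinf) (x : X) :
    ∀ᵐ ω ∂P, crit τ H x (Pinf ω) = H (Pinf ω) := by
  have h : (fun ω => (H (Pinf ω) : ℝ≥0∞)) =ᵐ[P] fun ω => crit τ H x (Pinf ω) := by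
    refine ae_eq_of_setLIntegral_eq_iSup D.natFiltration ?_ ?_ ?_ fun n S hS =>
      setLIntegral_crit_eq hd hui hcont hsuper D hD hP x hS
    · exact (hd.measurable_H.comp hP.measurable).coe_nnreal_ennreal
    · exact (measurable_crit τ hd.measurable_H).comp (measurable_const.prodMk hP.measurable)
    · have := hd.setLIntegral hui D.measurable_ξ D.isGaussian_map hP (S := Set.univ)
        MeasurableSet.univ
      rw [Measure.restrict_univ] at this
      rw [this]
      exact ENNReal.ofReal_ne_top
  exact h.mono fun ω hω => hω.symm

theorem ae_maxGain_eq_zero (hd : IsDecomposition H L₀ H₁)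
    (hui : CondUniformIntegrable.{u, w} H₁) (hcont : CondContinuous.{u, w} H₁)
    (hsuper : SupermartingaleProperty.{u, w} τ H₁)
    (D : SeqDesign τ ν₀ Ω P) (hD : D.IsQuasiSUR H) {Pinf : Ω → GM X}
    (hP : IsCondLaw D.sigmaInf P D.ξ Pinf) :
    ∀ᵐ ω ∂P, maxGain τ H (Pinf ω) = 0 := by
  have hΩ : Nonempty Ω := nonempty_of_isProbabilityMeasure P
  -- Besides providing a dense sequence, nonemptiness is essential for the value 0: an empty
  -- supremum in `EReal` would be ⊥.
  have hX : Nonempty X := hΩ.map (D.pt 0)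
  filter_upwards [ae_all_iff.2 fun j => ae_crit_eq hd hui hcont hsuper D hD hP
    (TopologicalSpace.denseSeq X j)] with ω hω
  have h := crit_eq_of_dense hd hui hcont τ (Pinf ω) (TopologicalSpace.denseRange_denseSeq X) hω
  have hg : ∀ x, gain τ H x (Pinf ω) = 0 := by
    intro x
    rw [gain, h x]
    exact EReal.sub_self (by simp) (by simp)
  simp [maxGain, hg]

end SeqDesign

end

end

end SUR

theorem mainTheorem3 {X : Type u} [MetricSpace X] [CompactSpace X] [MeasurableSpace X]
    [BorelSpace X] (τ : C(X, ℝ≥0))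
    (H : SUR.GM X → ℝ≥0) (hH : Measurable H)
    (L₀ : C(X, ℝ) → ℝ) (hL₀ : Measurable L₀) (hL₀_int : ∀ ν : SUR.GM X, Integrable L₀ ν.meas)
    (H₁ : SUR.GM X → ℝ) (hH₁ : Measurable H₁)
    (hdecomp : ∀ ν : SUR.GM X, (H ν : ℝ) = ∫ f, L₀ f ∂ν.meas + H₁ ν)
    (hH₁_ui : SUR.CondUniformIntegrable.{u, w} H₁)
    (hH₁_cont : SUR.CondContinuous.{u, w} H₁)
    (hH₁_super : SUR.SupermartingaleProperty.{u, w} τ H₁)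
    {Ω : Type w} [MeasurableSpace Ω] (P : Measure Ω) [IsProbabilityMeasure P]
    (ν₀ : SUR.GM X) (D : SUR.SeqDesign τ ν₀ Ω P) (hD : D.IsQuasiSUR H) :
    (∃ Pinf : Ω → SUR.GM X, SUR.IsCondLaw D.sigmaInf P D.ξ Pinf) ∧
      ∀ Pinf : Ω → SUR.GM X, SUR.IsCondLaw D.sigmaInf P D.ξ Pinf →
        ∀ᵐ ω ∂P, SUR.maxGain τ H (Pinf ω) = 0 :=
  ⟨D.exists_isCondLaw_sigmaInf, fun _ hP =>
    SUR.SeqDesign.ae_maxGain_eq_zero ⟨hH, hL₀, hL₀_int, hdecomp⟩ hH₁_ui hH₁_cont hH₁_super D hD hP⟩
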